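/- For a finite group $G$, the integer group determinants of $G$ are the integers $\det\left(a_{gh^{-1}}\right)_{g,h\in G}$ with $a_g\in\mathbb Z$ for all $g\in G$. Let $G=\mathbb Z_2\times Q_8$, where $Q_8=\langle A,B : A^4=1,\ B^2=A^2,\ AB=BA^{-1}\rangle$. (a) The odd integer group determinants of $G$ are exactly the integers $\equiv 1 \bmod 16$, together with the integers $\equiv 9 \bmod 16$ of the form $s_1s_2(\ell_1\ell_2)^2$ for some $s_1,s_2\in\mathbb Z$ and $\ell_1,\ell_2\in\mathbb N$ with $s_1,s_2\equiv -3 \bmod 8$, $\ell_1,\ell_2\equiv 3\bmod 4$, and either $$s_1\equiv s_2 \bmod 16 \ \text{ and }\ \ell_1\equiv \ell_2 \bmod 8, \qquad\text{or}\qquad s_1\equiv s_2+8 \bmod 16\ \text{ and }\ \ell_1\equiv \ell_2+4 \bmod 8.$$ (b) The even integer group determinants of $G$ are exactly: the $2^{18}m$ with $m\in\mathbb Z$; the $2^{17}(2m+1)p^2$ with $m\in\mathbb Z$ and $p$ a prime, $p\equiv 3\bmod 4$; the $2^{16}m$ with $m\equiv 1,3$ or $5 \bmod 8$; and those $2^{16}m$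 with $m\equiv 7\bmod 8$ that are of the form $2^{16}(8t-1)\ell^2$ with $t\in\mathbb Z$, $\ell\in\mathbb N$, $\ell\equiv 1\bmod 4$, $\ell\ge 5$, or of the form $2^{16}(8t+3)(8k-3)$ with $t,k\in\mathbb Z$. (c) Let $a_g\in\mathbb Z$ $(g\in G)$ be given. Let $f_1,f_2,g_1,g_2$ be the polynomials of degree at most $3$ whose coefficients of $x^j$, $0\le j\le 3$, are $a_g$ for $g=(0,A^j)$, $(1,A^j)$, $(0,BA^j)$, $(1,BA^j)$ respectively, and put $$\ell(z)=|f_1(i)+zf_2(i)|^2+|g_1(i)+zg_2(i)|^2 .$$ If $\ell(1)=\ell(-1)=2$ and $\det\left(a_{gh^{-1}}\right)=2^{16}m$ with $m\equiv 7\bmod 8$, then this determinant is of the form $2^{16}(8t+3)(8k-3)$ with $t,k\in\mathbb Z$. -/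

import Mathlib

/-- The group determinant `det (a_{g h⁻¹})` of the element `∑ a_g g`, given by its coefficients. -/
def groupDet {G R : Type*} [Group G] [Fintype G] [DecidableEq G] [CommRing R] (a : G → R) : R :=
  Matrix.det (Matrix.of fun g h : G => a (g * h⁻¹))

/-- The set `𝒮(G)` of integer group determinants of `G`. -/
def integerGroupDets (G : Type*) [Group G] [Fintype G] [DecidableEq G] : Set ℤ :=
  Set.range fun a : G → ℤ => groupDet a

/-- The group `ℤ₂ × Q₈`, with `ℤ₂` written multiplicatively. In Mathlib's `QuaternionGroup 2`,
`a j` is `A ^ j` and `xa j` is `B * A ^ j`, where `A ^ 4 = 1`, `B ^ 2 = A ^ 2`,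
`A * B = B * A⁻¹`. -/
abbrev Z2Q8 : Type := Multiplicative (ZMod 2) × QuaternionGroup 2

/-- The coefficient of `h` in the image of `∑ a_g g` in the group ring of `Q₈` when the generator
of `ℤ₂` is sent to the scalar `z`. -/
def evalZ2 (a : Z2Q8 → ℤ) (z : ℤ) (h : QuaternionGroup 2) : ℤ :=
  a (Multiplicative.ofAdd 0, h) + z * a (Multiplicative.ofAdd 1, h)

/-- `|f(i)|² + |g(i)|²`, where `f` and `g` are the cubics whose coefficients of `x ^ j` are
those of `A ^ j` and `B * A ^ j` in `∑ b_h h`. -/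
noncomputable def ellQ8 (b : QuaternionGroup 2 → ℤ) : ℝ :=
  ‖∑ j : Fin 4, (b (QuaternionGroup.a (j : ℕ)) : ℂ) * Complex.I ^ (j : ℕ)‖ ^ 2 +
    ‖∑ j : Fin 4, (b (QuaternionGroup.xa (j : ℕ)) : ℂ) * Complex.I ^ (j : ℕ)‖ ^ 2

/-! The characters of `ℤ₂` and of the centre of `Q₈` split the determinant into `kleinDet x *
kleinDet y * (sumSq z * sumSq t) ^ 2`, where `x, y` are images in the group ring of the Klein
four-group and `z, t` are integral quaternions (`groupDet_Z2Q8_eq`). By Fourier inversion the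
quadruples that occur are exactly those that are `Linked` coordinate by coordinate. Necessity:
`kleinDet` and `sumSq` are symmetric, so only the number of odd coordinates matters. One gives `1
mod 16`, three give the `9 mod 16` family, none or four give `2 ^ 16 * m` with `m` congruent to `0`
or `1` mod `4`. With two, the halves of the even coordinates govern the power of `2` and the
residues of the factors. When `m ≡ 7 mod 8` and no `(8t+3)(8k-3)` splitting is visible, a parity
count excludes `z, t` both of norm `2`; this yields both `ℓ ≥ 5` and part (c). Sufficiency: explicit
`x, y` are combined with sums of four squares. Coordinates at which everything is odd can be linked
by a sign change, so only even coordinates impose conditions. The form with `ℓ ≥ 5` needs `2ℓ` as a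
sum of four squares with both even entries `≡ 2 mod 4`, hence `2ℓ - 4` as a sum of three squares
(`exists_sum_three_squares`). -/

/-- The product of the values of the four characters of the Klein four-group on `v`, written as a
symmetric polynomial. -/
def kleinDet (v : Fin 4 → ℤ) : ℤ := 2 * ∑ i, v i ^ 4 - (∑ i, v i ^ 2) ^ 2 + 8 * ∏ i, v i

/-- The sum of the squares of four integers. -/
def sumSq (w : Fin 4 → ℤ) : ℤ := ∑ i, w i ^ 2

/-- This invariance allows the coordinates to be sorted by parity. -/
lemma kleinDet_comp_perm (v : Fin 4 → ℤ) (σ : Equiv.Perm (Fin 4)) :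
    kleinDet (v ∘ σ) = kleinDet v := by
  simp only [kleinDet, Function.comp_apply]
  rw [Equiv.sum_comp σ (fun i => v i ^ 4), Equiv.sum_comp σ (fun i => v i ^ 2), Equiv.prod_comp σ v]

lemma sumSq_comp_perm (w : Fin 4 → ℤ) (σ : Equiv.Perm (Fin 4)) : sumSq (w ∘ σ) = sumSq w := by
  simp only [sumSq, Function.comp_apply]
  rw [Equiv.sum_comp σ (fun i => w i ^ 2)]

lemma kleinDet_eq (v : Fin 4 → ℤ) :
    kleinDet v = ((v 2 + v 3) ^ 2 - (v 0 + v 1) ^ 2) * ((v 2 - v 3) ^ 2 - (v 0 - v 1) ^ 2) := by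
  simp only [kleinDet, Fin.sum_univ_four, Fin.prod_univ_four]
  ring

/-! ### The determinant of `Q₈` -/

lemma Matrix.det_fromBlocks_symm {n R : Type*} [Fintype n] [DecidableEq n] [CommRing R]
    (X Y : Matrix n n R) :
    (Matrix.fromBlocks X Y Y X).det = (X + Y).det * (X - Y).det := by
  have h : Matrix.fromBlocks (1 : Matrix n n R) 1 0 1 * Matrix.fromBlocks X Y Y X *
      Matrix.fromBlocks 1 (-1) 0 1 = Matrix.fromBlocks (X + Y) 0 Y (X - Y) := by
    simp only [Matrix.fromBlocks_multiply]
    congr 1 <;> simp <;> abel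
  have h' := congrArg Matrix.det h
  simpa only [Matrix.det_mul, Matrix.det_fromBlocks_zero₂₁, Matrix.det_fromBlocks_zero₁₂,
    Matrix.det_one, one_mul, mul_one] using h'

namespace QuaternionGroup

/-- Representatives of the cosets of the centre of `Q₈`. -/
def cosetRep : Fin 4 → QuaternionGroup 2 := ![a 0, a 1, xa 0, xa 1]

/-- `Q₈` as the disjoint union of the coset representatives and their products with `A ^ 2`. -/
noncomputable def splitEquiv : Fin 4 ⊕ Fin 4 ≃ QuaternionGroup 2 :=
  Equiv.ofBijective (Sum.elim cosetRep fun i => cosetRep i * a 2) (by decide)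

/-- The image of `b` in the group ring of `Q₈` modulo its centre. -/
def evenPart (b : QuaternionGroup 2 → ℤ) : Fin 4 → ℤ :=
  fun i => b (cosetRep i) + b (cosetRep i * a 2)

/-- The coordinates of the quaternion that is the image of `b`. -/
def oddPart (b : QuaternionGroup 2 → ℤ) : Fin 4 → ℤ :=
  fun i => b (cosetRep i) - b (cosetRep i * a 2)

lemma groupDet_eq (b : QuaternionGroup 2 → ℤ) :
    groupDet b = kleinDet (evenPart b) * sumSq (oddPart b) ^ 2 := by
  have hc : ∀ i j, cosetRep i * a 2 * (cosetRep j * a 2)⁻¹ = cosetRep i * (cosetRep j)⁻¹ := by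
    decide
  have hc' : ∀ i j, cosetRep i * (cosetRep j * a 2)⁻¹ = cosetRep i * a 2 * (cosetRep j)⁻¹ := by
    decide
  have h : (Matrix.of fun g h => b (g * h⁻¹)).submatrix splitEquiv splitEquiv =
      Matrix.fromBlocks (Matrix.of fun i j => b (cosetRep i * (cosetRep j)⁻¹))
        (Matrix.of fun i j => b (cosetRep i * a 2 * (cosetRep j)⁻¹))
        (Matrix.of fun i j => b (cosetRep i * a 2 * (cosetRep j)⁻¹))
        (Matrix.of fun i j => b (cosetRep i * (cosetRep j)⁻¹)) := by
    ext (i | i) (j | j) <;>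
      simp only [splitEquiv, Matrix.submatrix_apply, Equiv.ofBijective_apply, Sum.elim_inl,
        Sum.elim_inr, Matrix.of_apply, Matrix.fromBlocks_apply₁₁, Matrix.fromBlocks_apply₁₂,
        Matrix.fromBlocks_apply₂₁, Matrix.fromBlocks_apply₂₂, hc, hc']
  rw [groupDet, ← Matrix.det_submatrix_equiv_self splitEquiv, h, Matrix.det_fromBlocks_symm]
  -- The sum of the blocks is a group matrix of the Klein four-group; their difference is the matrix
  -- of multiplication by a quaternion, whose determinant is the square of the norm.
  have e1 : ((Matrix.of fun i j => b (cosetRep i * (cosetRep j)⁻¹)) +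
      Matrix.of fun i j => b (cosetRep i * a 2 * (cosetRep j)⁻¹)) =
      let v := evenPart b
      !![v 0, v 1, v 2, v 3; v 1, v 0, v 3, v 2; v 2, v 3, v 0, v 1; v 3, v 2, v 1, v 0] := by
    ext i j
    fin_cases i <;> fin_cases j <;> first | rfl | exact add_comm _ _
  have e2 : ((Matrix.of fun i j => b (cosetRep i * (cosetRep j)⁻¹)) -
      Matrix.of fun i j => b (cosetRep i * a 2 * (cosetRep j)⁻¹)) =
      let w := oddPart b
      !![w 0, -w 1, -w 2, -w 3; w 1, w 0, w 3, -w 2; w 2, -w 3, w 0, w 1;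
        w 3, w 2, -w 1, w 0] := by
    ext i j
    fin_cases i <;> fin_cases j <;> first | rfl | exact (neg_sub _ _).symm
  rw [e1, e2]
  simp [Matrix.det_succ_row_zero, Fin.sum_univ_succ, Fin.succAbove, kleinDet, sumSq,
    Fin.prod_univ_succ]
  ring

end QuaternionGroup

/-! ### Reduction of unimodular forms and sums of three squares -/

/-- A positive definite binary form of determinant one is a Gram form. -/
lemma exists_gram_two (N : ℕ) : ∀ a b c : ℤ, 0 < a → a ≤ N → a * c - b ^ 2 = 1 →
    ∃ p q r s : ℤ, p ^ 2 + r ^ 2 = a ∧ p * q + r * s = b ∧ q ^ 2 + s ^ 2 = c := by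
  induction N with
  | zero => intro a b c h1 h2; simp at h2; omega
  | succ N ih =>
    intro a b c ha hN hdet
    rcases eq_or_lt_of_le (show 1 ≤ a from ha) with h1 | h1
    · subst h1
      exact ⟨1, b, 0, 1, by norm_num, by ring, by linarith⟩
    · obtain ⟨k, b', hb, hb1, hb2⟩ : ∃ k b' : ℤ, b = b' - k * a ∧ -a ≤ 2 * b' ∧ 2 * b' ≤ a := by
        refine ⟨-((2 * b + a) / (2 * a)), b - ((2 * b + a) / (2 * a)) * a, by ring, ?_, ?_⟩
        · have := Int.mul_ediv_self_le (x := 2 * b + a) (k := 2 * a) (by omega)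
          linarith
        · have := Int.lt_mul_ediv_self_add (x := 2 * b + a) (k := 2 * a) (by omega)
          linarith
      have hdet' : a * (c + 2 * k * b + k ^ 2 * a) - b' ^ 2 = 1 := by
        subst hb; linear_combination hdet
      generalize hc' : c + 2 * k * b + k ^ 2 * a = c' at hdet'
      have hc0 : 0 < c' := by
        by_contra h
        nlinarith [sq_nonneg b']
      -- Here `a * c' = 1 + b' ^ 2 ≤ 1 + a ^ 2 / 4` and `a ≥ 2`, so exchanging the two variables
      -- lowers the leading coefficient.
      have hca : c' < a := by
        by_contra h
        nlinarith
      obtain ⟨p, q, r, s, e1, e2, e3⟩ := ih c' b' a hc0 (by push_cast at hN; omega)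
        (by linarith)
      refine ⟨q, p - k * q, s, r - k * s, e3, ?_, ?_⟩
      · rw [hb]; linear_combination e2 - k * e3
      · subst hb; linear_combination e1 - 2 * k * e2 + k ^ 2 * e3 - hc'

/-- Every integer can be moved by a multiple of `a` into `[-a/2, a/2]`. -/
lemma exists_balanced (a b : ℤ) (ha : 0 < a) :
    ∃ k b' : ℤ, b' = b + k * a ∧ 4 * b' ^ 2 ≤ a ^ 2 := by
  refine ⟨-((2 * b + a) / (2 * a)), _, rfl, ?_⟩
  have h1 := Int.mul_ediv_self_le (x := 2 * b + a) (k := 2 * a) (by omega)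
  have h2 := Int.lt_mul_ediv_self_add (x := 2 * b + a) (k := 2 * a) (by omega)
  nlinarith

/-- A positive definite ternary form of determinant one is a Gram form. -/
lemma exists_gram_three (N : ℕ) : ∀ a b c r s t : ℤ, 0 < a → 0 < a * b - t ^ 2 →
    a + (a * b - t ^ 2) ≤ N →
    a * b * c + 2 * r * s * t - a * r ^ 2 - b * s ^ 2 - c * t ^ 2 = 1 →
    ∃ u v w : Fin 3 → ℤ, u ⬝ᵥ u = a ∧ v ⬝ᵥ v = b ∧ w ⬝ᵥ w = c ∧
      v ⬝ᵥ w = r ∧ u ⬝ᵥ w = s ∧ u ⬝ᵥ v = t := by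
  induction N with
  | zero => intro a b c r s t h1 h2 h3; simp at h3; omega
  | succ N ih =>
    intro a b c r s t ha hC hN hdet
    push_cast at hN
    rcases eq_or_lt_of_le (show 1 ≤ a from ha) with h1 | h1
    · subst h1
      obtain ⟨p, q, p', q', e1, e2, e3⟩ := exists_gram_two (b - t ^ 2).toNat (b - t ^ 2)
        (r - s * t) (c - s ^ 2) (by linarith) (Int.self_le_toNat _) (by linear_combination hdet)
      refine ⟨![1, 0, 0], ![t, p, p'], ![s, q, q'], ?_⟩
      simp only [dotProduct, Fin.sum_univ_three, Matrix.cons_val]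
      refine ⟨by ring, by linear_combination e1, by linear_combination e3,
        by linear_combination e2, by ring, by ring⟩
    -- Descent on `a` plus the minor `a * b - t ^ 2`: replacing `v` by `v + k • u` balances `t` and
    -- keeps the minor.
    obtain ⟨k, t', ht, ht'⟩ := exists_balanced a t ha
    obtain ⟨b', hb⟩ : ∃ b', b' = b + 2 * k * t + k ^ 2 * a := ⟨_, rfl⟩
    obtain ⟨r', hr⟩ : ∃ r', r' = r + k * s := ⟨_, rfl⟩
    have hC' : a * b' - t' ^ 2 = a * b - t ^ 2 := by subst ht hb; ring
    have hdet1 : a * b' * c + 2 * r' * s * t' - a * r' ^ 2 - b' * s ^ 2 - c * t' ^ 2 = 1 := by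
      subst ht hb hr; linear_combination hdet
    suffices h : ∃ u v w : Fin 3 → ℤ, u ⬝ᵥ u = a ∧ v ⬝ᵥ v = b' ∧ w ⬝ᵥ w = c ∧
        v ⬝ᵥ w = r' ∧ u ⬝ᵥ w = s ∧ u ⬝ᵥ v = t' by
      obtain ⟨u, v, w, e1, e2, e3, e4, e5, e6⟩ := h
      refine ⟨u, v - k • u, w, e1, ?_, e3, ?_, e5, ?_⟩
      · simp only [dotProduct_sub, sub_dotProduct, dotProduct_smul, smul_dotProduct, smul_eq_mul,
          dotProduct_comm v u]
        subst ht; linear_combination e2 + hb - 2 * k * e6 + k ^ 2 * e1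
      · simp only [sub_dotProduct, smul_dotProduct, smul_eq_mul]
        linear_combination e4 + hr - k * e5
      · simp only [dotProduct_sub, dotProduct_smul, smul_eq_mul]
        linear_combination e6 + ht - k * e1
    rw [← hC'] at hC hN
    clear hdet hb hr hC'
    have hb0 : 0 < b' := by
      by_contra h
      nlinarith [sq_nonneg t']
    -- Exchanging `u` and `v` keeps the minor and lowers `a`.
    by_cases hba : b' < a
    · obtain ⟨u, v, w, e1, e2, e3, e4, e5, e6⟩ := ih b' a c s r' t' hb0 (by linarith)
        (by linarith) (by linear_combination hdet1)
      exact ⟨v, u, w, e2, e1, e3, e5, e4, by rw [dotProduct_comm]; exact e6⟩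
    obtain ⟨C, hCd⟩ : ∃ C, C = a * b' - t' ^ 2 := ⟨_, rfl⟩
    rw [← hCd] at hC hN
    -- Now the adjoint form is reduced: replacing `w` by `w + k • v` balances its off-diagonal entry
    -- modulo `C`.
    obtain ⟨k, R, hR, hR'⟩ := exists_balanced C (a * r' - s * t') hC
    obtain ⟨c', hc'⟩ : ∃ c', c' = c + 2 * k * r' + k ^ 2 * b' := ⟨_, rfl⟩
    obtain ⟨r'', hr''⟩ : ∃ r'', r'' = r' + k * b' := ⟨_, rfl⟩
    obtain ⟨s', hs'⟩ : ∃ s', s' = s + k * t' := ⟨_, rfl⟩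
    have hR2 : R = a * r'' - s' * t' := by subst hR hr'' hs' hCd; ring
    have hdet2 : a * b' * c' + 2 * r'' * s' * t' - a * r'' ^ 2 - b' * s' ^ 2 - c' * t' ^ 2 = 1 := by
      subst hc' hr'' hs'; linear_combination hdet1
    have hB : C * (a * c' - s' ^ 2) = a + R ^ 2 := by
      rw [hR2, hCd]; linear_combination a * hdet2
    have hB0 : 0 < a * c' - s' ^ 2 := by
      by_contra h
      nlinarith [sq_nonneg R]
    -- Otherwise the two balance conditions give `3 * C ^ 2 ≤ 4 * a` and `3 * a ^ 2 ≤ 4 * C`,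
    -- impossible for `a ≥ 2`. Exchanging `v` and `w` then keeps `a` and lowers the minor.
    have hBC : a * c' - s' ^ 2 < C := by
      by_contra h
      have i1 : 3 * C ^ 2 ≤ 4 * a := by nlinarith
      have i2 : 3 * a ^ 2 ≤ 4 * C := by nlinarith
      nlinarith
    obtain ⟨u, v, w, e1, e2, e3, e4, e5, e6⟩ := ih a c' b' r'' t' s' ha hB0 (by linarith)
      (by linear_combination hdet2)
    refine ⟨u, w, v - k • w, e1, e3, ?_, ?_, ?_, e5⟩
    · simp only [dotProduct_sub, sub_dotProduct, dotProduct_smul, smul_dotProduct, smul_eq_mul,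
        dotProduct_comm w v]
      subst hr''; linear_combination e2 + hc' - 2 * k * e4 + k ^ 2 * e3
    · simp only [dotProduct_sub, dotProduct_smul, smul_eq_mul, dotProduct_comm w v]
      linear_combination e4 + hr'' - k * e3
    · simp only [dotProduct_sub, dotProduct_smul, smul_eq_mul]
      linear_combination e6 + hs' - k * e5

/-- Every natural number `≡ 2 mod 4` is a sum of three squares. -/
theorem exists_sum_three_squares {n : ℕ} (hn : n % 4 = 2) :
    ∃ x y z : ℤ, x ^ 2 + y ^ 2 + z ^ 2 = n := by
  have hcop : (n - 1).Coprime (4 * n) := by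
    refine Nat.Coprime.mul_right ?_ ?_
    · exact (Nat.coprime_pow_right_iff (n := 2) (by norm_num) _ 2).2
        (Nat.coprime_two_right.2 (Nat.odd_iff.2 (by omega)))
    · have := (Nat.coprime_self_sub_right (m := 1) (n := n) (by omega)).2 (by simp)
      exact this.symm
  -- Dirichlet's theorem supplies a prime `q = d * n - 1` with `d ≡ 1 mod 4`; as `n ≡ 2 mod 4`, also
  -- `q ≡ 1 mod 4`.
  obtain ⟨q, hqn, hq, hqm⟩ := Nat.forall_exists_prime_gt_and_modEq (4 * n) (by omega) hcop
  obtain ⟨m, hm⟩ : ∃ m, q = (4 * m + 1) * n - 1 := by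
    obtain ⟨m, hm⟩ := (Nat.modEq_iff_dvd' (by omega)).1 hqm.symm
    exact ⟨m, by have : (4 * m + 1) * n = 4 * n * m + n := by ring
                 omega⟩
  set d := 4 * m + 1 with hd
  have hdn : q + 1 = d * n := by have : 0 < d * n := Nat.mul_pos (by omega) (by omega)
                                 omega
  have hq4 : q % 4 = 1 := by
    have := congrArg (· % 4) hdn
    simp [Nat.add_mod, Nat.mul_mod, hd, hn] at this
    omega
  have := Fact.mk hq
  -- By reciprocity `(d/q) = (q/d) = (-1/d) = 1`, since `q ≡ -1 mod d`.
  have hleg : legendreSym q (-(d : ℤ)) = 1 := by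
    have h1 : jacobiSym (-1) q = 1 := by
      rw [jacobiSym.at_neg_one (Nat.odd_iff.2 (by omega)), ZMod.χ₄_nat_one_mod_four hq4]
    have h2 : jacobiSym d q = 1 := by
      rw [jacobiSym.quadratic_reciprocity_one_mod_four (by omega) (Nat.odd_iff.2 (by omega)),
        jacobiSym.mod_left' (a₂ := -1) (b := d), jacobiSym.at_neg_one (Nat.odd_iff.2 (by omega)),
        ZMod.χ₄_nat_one_mod_four (by omega)]
      refine Int.ModEq.symm ((Int.modEq_iff_dvd).2 ⟨n, ?_⟩)
      rw [sub_neg_eq_add]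
      exact_mod_cast hdn
    rw [jacobiSym.legendreSym.to_jacobiSym, neg_eq_neg_one_mul, jacobiSym.mul_left, h1, h2, one_mul]
  have hne : ((-(d : ℤ) : ℤ) : ZMod q) ≠ 0 := by
    intro h
    rw [(legendreSym.eq_zero_iff q _).2 h] at hleg
    exact zero_ne_one hleg
  obtain ⟨h0, hh0⟩ := (legendreSym.eq_one_iff q hne).1 hleg
  obtain ⟨h, rfl⟩ := ZMod.intCast_surjective h0
  have hdiv : (q : ℤ) ∣ h ^ 2 + d := by
    rw [← ZMod.intCast_zmod_eq_zero_iff_dvd]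
    push_cast at hh0 ⊢
    linear_combination -hh0
  obtain ⟨a, ha⟩ := hdiv
  have hq0 : (0 : ℤ) < q := by exact_mod_cast hq.pos
  have hd0 : (0 : ℤ) < d := by exact_mod_cast (by omega : 0 < d)
  have hdn' : (q : ℤ) + 1 = d * n := by exact_mod_cast hdn
  have ha0 : 0 < a := by
    by_contra hc
    nlinarith [sq_nonneg h]
  -- The form with rows `(a, h, 1)`, `(h, q, 0)`, `(1, 0, n)` has determinant `n * (a * q - h ^ 2) -
  -- q = n * d - q = 1` and takes the value `n` at its last basis vector.
  obtain ⟨u, v, w, -, -, e, -⟩ := exists_gram_three (a + (a * q - h ^ 2)).toNat a q n 0 1 h ha0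
    (by linarith) (Int.self_le_toNat _) (by linear_combination (-n : ℤ) * ha - hdn')
  refine ⟨w 0, w 1, w 2, ?_⟩
  rw [← e]
  simp only [dotProduct, Fin.sum_univ_three]
  ring

/-! ### The determinant of `ℤ₂ × Q₈` in linked coordinates -/

/-- The relation between the corresponding coordinates of the two even parts `x`, `y` and the two
odd parts `z`, `t` of the images in the group ring of `Q₈` of an element of that of `ℤ₂ × Q₈`. -/
def Linked (x y z t : ℤ) : Prop :=
  (2 ∣ x - y ∧ 2 ∣ x - z ∧ 2 ∣ x - t) ∧ 4 ∣ x + y + z + t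

open QuaternionGroup in
lemma linked_evenPart_oddPart (a : Z2Q8 → ℤ) (i : Fin 4) :
    Linked (evenPart (evalZ2 a 1) i) (evenPart (evalZ2 a (-1)) i)
      (oddPart (evalZ2 a 1) i) (oddPart (evalZ2 a (-1)) i) := by
  simp only [Linked, evenPart, oddPart, evalZ2]
  omega

/-- `ℤ₂ × Q₈` as the disjoint union of two copies of `Q₈`. -/
noncomputable def Z2Q8.splitEquiv : QuaternionGroup 2 ⊕ QuaternionGroup 2 ≃ Z2Q8 :=
  Equiv.ofBijective
    (Sum.elim (fun h => (Multiplicative.ofAdd 0, h)) fun h => (Multiplicative.ofAdd 1, h))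
    (by
      constructor
      · have h01 : Multiplicative.ofAdd (0 : ZMod 2) ≠ Multiplicative.ofAdd 1 := by decide
        rintro (g | g) (h | h) e <;> obtain ⟨e1, rfl⟩ := Prod.ext_iff.1 e
        · rfl
        · exact absurd e1 h01
        · exact absurd e1.symm h01
        · rfl
      · rintro ⟨z, h⟩
        have hz : z = Multiplicative.ofAdd 0 ∨ z = Multiplicative.ofAdd 1 := by
          revert z; decide
        rcases hz with rfl | rfl
        · exact ⟨Sum.inl h, rfl⟩
        · exact ⟨Sum.inr h, rfl⟩)

lemma groupDet_Z2Q8 (a : Z2Q8 → ℤ) :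
    groupDet a = groupDet (evalZ2 a 1) * groupDet (evalZ2 a (-1)) := by
  have h : (Matrix.of fun g h => a (g * h⁻¹)).submatrix Z2Q8.splitEquiv Z2Q8.splitEquiv =
      Matrix.fromBlocks (Matrix.of fun g h => a (Multiplicative.ofAdd 0, g * h⁻¹))
        (Matrix.of fun g h => a (Multiplicative.ofAdd 1, g * h⁻¹))
        (Matrix.of fun g h => a (Multiplicative.ofAdd 1, g * h⁻¹))
        (Matrix.of fun g h => a (Multiplicative.ofAdd 0, g * h⁻¹)) := by
    have key : ∀ z w u : Multiplicative (ZMod 2), z * w⁻¹ = u → ∀ i j : QuaternionGroup 2,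
        a ((z, i) * (w, j)⁻¹) = a (u, i * j⁻¹) := by
      rintro z w u rfl i j
      rfl
    ext (i | i) (j | j) <;> exact key _ _ _ (by decide) i j
  rw [groupDet, ← Matrix.det_submatrix_equiv_self Z2Q8.splitEquiv, h, Matrix.det_fromBlocks_symm,
    groupDet, groupDet]
  congr 2 <;> ext i j <;> simp [evalZ2, sub_eq_add_neg]

open QuaternionGroup in
lemma groupDet_Z2Q8_eq (a : Z2Q8 → ℤ) :
    groupDet a = kleinDet (evenPart (evalZ2 a 1)) * kleinDet (evenPart (evalZ2 a (-1))) *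
      (sumSq (oddPart (evalZ2 a 1)) * sumSq (oddPart (evalZ2 a (-1)))) ^ 2 := by
  rw [groupDet_Z2Q8, QuaternionGroup.groupDet_eq, QuaternionGroup.groupDet_eq]
  ring

open QuaternionGroup in
-- Fourier inversion on `ℤ₂` times the centre: linkedness is exactly the integrality of the four
-- signed sums divided by `4`.
lemma mem_integerGroupDets_of_linked {x y z t : Fin 4 → ℤ}
    (h : ∀ i, Linked (x i) (y i) (z i) (t i)) :
    kleinDet x * kleinDet y * (sumSq z * sumSq t) ^ 2 ∈ integerGroupDets Z2Q8 := by
  let c : ZMod 2 → Fin 4 ⊕ Fin 4 → ℤ := fun k =>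
    if k = 0 then Sum.elim (fun i => (x i + y i + z i + t i) / 4)
      fun i => (x i + y i - z i - t i) / 4
    else Sum.elim (fun i => (x i - y i + z i - t i) / 4) fun i => (x i - y i - z i + t i) / 4
  let a : Z2Q8 → ℤ := fun g => c g.1.toAdd (splitEquiv.symm g.2)
  have hl : ∀ i, splitEquiv.symm (cosetRep i) = Sum.inl i := fun i =>
    (Equiv.symm_apply_eq _).2 rfl
  have hr : ∀ i, splitEquiv.symm (cosetRep i * QuaternionGroup.a 2) = Sum.inr i := fun i =>
    (Equiv.symm_apply_eq _).2 rfl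
  refine ⟨a, ?_⟩
  have e1 : evenPart (evalZ2 a 1) = x := by
    ext i
    have := h i
    simp only [Linked] at this
    simp [evenPart, evalZ2, a, hl, hr, c]
    omega
  have e2 : evenPart (evalZ2 a (-1)) = y := by
    ext i
    have := h i
    simp only [Linked] at this
    simp [evenPart, evalZ2, a, hl, hr, c]
    omega
  have e3 : oddPart (evalZ2 a 1) = z := by
    ext i
    have := h i
    simp only [Linked] at this
    simp [oddPart, evalZ2, a, hl, hr, c]
    omega
  have e4 : oddPart (evalZ2 a (-1)) = t := by
    ext i
    have := h i
    simp only [Linked] at this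
    simp [oddPart, evalZ2, a, hl, hr, c]
    omega
  simp only [groupDet_Z2Q8_eq, e1, e2, e3, e4]

open QuaternionGroup in
lemma ellQ8_eq (b : QuaternionGroup 2 → ℤ) : ellQ8 b = (sumSq (oddPart b) : ℝ) := by
  have key : ∀ p q r s : ℤ,
      ‖(p : ℂ) + q * Complex.I - r - s * Complex.I‖ ^ 2 = ((p : ℝ) - r) ^ 2 + (q - s) ^ 2 := by
    intro p q r s
    rw [Complex.sq_norm, Complex.normSq_apply]
    simp
    ring
  have hI : Complex.I ^ 3 = -Complex.I := by rw [pow_succ, Complex.I_sq]; ring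
  have h1 := key (b (a 0)) (b (a 1)) (b (a 2)) (b (a 3))
  have h2 := key (b (xa 0)) (b (xa 1)) (b (xa 2)) (b (xa 3))
  have e1 : oddPart b 0 = b (a 0) - b (a 2) := rfl
  have e2 : oddPart b 1 = b (a 1) - b (a 3) := rfl
  have e3 : oddPart b 2 = b (xa 0) - b (xa 2) := rfl
  have e4 : oddPart b 3 = b (xa 1) - b (xa 3) := rfl
  rw [sumSq, Fin.sum_univ_four, e1, e2, e3, e4, ellQ8, Fin.sum_univ_four, Fin.sum_univ_four]
  push_cast
  simp only [Fin.val_zero, Fin.val_one, Fin.val_two, show ((3 : Fin 4) : ℕ) = 3 from rfl,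
    Nat.cast_zero, Nat.cast_one, Nat.cast_ofNat, pow_zero, pow_one, Complex.I_sq, hI,
    mul_one, mul_neg, ← sub_eq_add_neg]
  rw [h1, h2]
  ring

/-! ### Residues of `kleinDet` and `sumSq` by the number of odd entries -/

section Necessity

lemma exists_perm_sorted_parity (v : Fin 4 → ℤ) :
    ∃ σ : Equiv.Perm (Fin 4), Monotone fun i => v (σ i) % 2 :=
  ⟨_, Tuple.monotone_sort fun i => v i % 2⟩

/-- One odd entry. -/
lemma kleinDet_modEq_of_one_odd {v : Fin 4 → ℤ} (c : Fin 4 → ℤ) (h0 : v 0 = 2 * c 0)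
    (h1 : v 1 = 2 * c 1) (h2 : v 2 = 2 * c 2) (h3 : v 3 = 2 * c 3 + 1) :
    kleinDet v ≡ 1 + 8 * (c 0 + c 1 + c 2) [ZMOD 16] ∧
      sumSq v ^ 2 ≡ 1 + 8 * (c 0 + c 1 + c 2) [ZMOD 16] := by
  -- Modulo `16` the two quantities reduce to `1 ∓ 8 * (c 0 ^ 2 + c 1 ^ 2 + c 2 ^ 2)`, so the
  -- squares can be dropped and the signs agree.
  have i1 : ∀ c : ZMod 16, 8 * c ^ 2 = 8 * c := by decide
  have i4 : (16 : ZMod 16) = 0 := by decide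
  suffices h : (kleinDet v : ZMod 16) = (1 + 8 * (c 0 + c 1 + c 2) : ℤ) ∧
      ((sumSq v ^ 2 : ℤ) : ZMod 16) = (1 + 8 * (c 0 + c 1 + c 2) : ℤ) from
    h.imp (ZMod.intCast_eq_intCast_iff _ _ 16).1 (ZMod.intCast_eq_intCast_iff _ _ 16).1
  simp only [kleinDet, sumSq, Fin.sum_univ_four, Fin.prod_univ_four, h0, h1, h2, h3]
  push_cast
  generalize ((c 0 : ℤ) : ZMod 16) = x
  generalize ((c 1 : ℤ) : ZMod 16) = y
  generalize ((c 2 : ℤ) : ZMod 16) = z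
  generalize ((c 3 : ℤ) : ZMod 16) = t
  have i5 := i1 t
  have e : 8 * (t ^ 2 + t) = 0 := by linear_combination i5 + t * i4
  have e2 : (2 * t + 1) ^ 4 = 1 := by
    linear_combination e + (t ^ 4 + 2 * t ^ 3 + t ^ 2) * i4
  have e3 : 8 * (2 * t + 1) ^ 2 = 8 := by linear_combination (2 * t ^ 2 + 2 * t) * i4
  constructor
  · linear_combination e2 + (x ^ 4 + y ^ 4 + z ^ 4 - 2 * x ^ 2 * y ^ 2 - 2 * x ^ 2 * z ^ 2 -
      2 * y ^ 2 * z ^ 2 + 4 * x * y * z * (2 * t + 1)) * i4 - (x ^ 2 + y ^ 2 + z ^ 2) * e3 -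
      (i1 x + i1 y + i1 z) - (x + y + z) * i4
  · linear_combination e2 + (x ^ 2 + y ^ 2 + z ^ 2) ^ 2 * i4 + (x ^ 2 + y ^ 2 + z ^ 2) * e3 +
      (i1 x + i1 y + i1 z)

/-- Three odd entries. -/
lemma kleinDet_modEq_of_three_odd {v : Fin 4 → ℤ} (c : Fin 4 → ℤ) (h0 : v 0 = 2 * c 0)
    (h1 : v 1 = 2 * c 1 + 1) (h2 : v 2 = 2 * c 2 + 1) (h3 : v 3 = 2 * c 3 + 1) :
    kleinDet v ≡ -3 + 8 * c 0 [ZMOD 16] ∧ sumSq v ≡ 3 + 4 * c 0 [ZMOD 8] := by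
  have sq : ∀ c : ℤ, ∃ k, (2 * c + 1) ^ 2 = 8 * k + 1 := fun c => by
    obtain ⟨k, hk⟩ := Int.even_mul_succ_self c
    exact ⟨k, by linear_combination 4 * hk⟩
  obtain ⟨k, hk⟩ := Int.even_mul_succ_self (c 0)
  obtain ⟨k1, hk1⟩ := sq (c 1)
  obtain ⟨k2, hk2⟩ := sq (c 2)
  obtain ⟨k3, hk3⟩ := sq (c 3)
  have q : ∀ w k : ℤ, w ^ 2 = 8 * k + 1 → w ^ 4 = (8 * k + 1) ^ 2 := fun w k h => by
    rw [← h]; ring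
  have hc : c 0 ^ 2 = 2 * k - c 0 := by linear_combination hk
  simp only [kleinDet, sumSq, Fin.sum_univ_four, Fin.prod_univ_four, h0, h1, h2, h3]
  rw [q _ _ hk1, q _ _ hk2, q _ _ hk3, hk1, hk2, hk3]
  constructor
  · refine Int.modEq_iff_dvd.2 ⟨-(c 0 ^ 4) - 8 * (k1 ^ 2 + k2 ^ 2 + k3 ^ 2) + 4 * (k1 + k2 + k3) ^ 2
      + (k1 + k2 + k3) + 4 * c 0 ^ 2 * (k1 + k2 + k3)
      - (c 0) * (2 * c 1 + 1) * (2 * c 2 + 1) * (2 * c 3 + 1) + 3 * k - c 0, ?_⟩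
    linear_combination 24 * hc
  · refine Int.modEq_iff_dvd.2 ⟨c 0 - k - (k1 + k2 + k3), ?_⟩
    linear_combination -4 * hc

lemma kleinDet_emod_four (v : Fin 4 → ℤ) : kleinDet v ≡ 1 [ZMOD 4] ∨ 4 ∣ kleinDet v := by
  have h : ∀ a b c d : ZMod 4, 2 * (a ^ 4 + b ^ 4 + c ^ 4 + d ^ 4) -
      (a ^ 2 + b ^ 2 + c ^ 2 + d ^ 2) ^ 2 + 8 * (a * b * c * d) = 1 ∨
      2 * (a ^ 4 + b ^ 4 + c ^ 4 + d ^ 4) -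
      (a ^ 2 + b ^ 2 + c ^ 2 + d ^ 2) ^ 2 + 8 * (a * b * c * d) = 0 := by decide
  suffices h : (kleinDet v : ZMod 4) = (1 : ℤ) ∨ (kleinDet v : ZMod 4) = 0 from
    h.imp (ZMod.intCast_eq_intCast_iff _ _ 4).1 (ZMod.intCast_zmod_eq_zero_iff_dvd _ 4).1
  simp only [kleinDet, Fin.sum_univ_four, Fin.prod_univ_four]
  push_cast
  exact h _ _ _ _

lemma kleinDet_of_all_odd (c : Fin 4 → ℤ) :
    ∃ P, kleinDet (fun i => 2 * c i + 1) = 16 * P ∧ (P ≡ 3 [ZMOD 4] ∨ 4 ∣ P) := by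
  refine ⟨(c 0 + c 1 + c 2 + c 3 + 2) * (c 0 - c 1 + c 2 - c 3) * (c 0 + c 1 - c 2 - c 3) *
    (c 0 - c 1 - c 2 + c 3), ?_, ?_⟩
  · rw [kleinDet_eq]; ring
  have h : ∀ a b c d : ZMod 4, (a + b + c + d + 2) * (a - b + c - d) * (a + b - c - d) *
      (a - b - c + d) = 3 ∨ (a + b + c + d + 2) * (a - b + c - d) * (a + b - c - d) *
      (a - b - c + d) = 0 := by decide
  have := h (c 0) (c 1) (c 2) (c 3)
  refine this.imp (fun h => (ZMod.intCast_eq_intCast_iff _ _ 4).1 (by push_cast; exact h))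
    fun h => ?_
  exact (ZMod.intCast_zmod_eq_zero_iff_dvd _ 4).1 (by push_cast; exact h)

lemma sumSq_of_all_odd (c : Fin 4 → ℤ) : ∃ k, sumSq (fun i => 2 * c i + 1) = 4 * (2 * k + 1) := by
  have h : ∀ x : ℤ, ∃ k, (2 * x + 1) ^ 2 = 8 * k + 1 := fun x => by
    obtain ⟨k, hk⟩ := Int.even_mul_succ_self x
    exact ⟨k, by linear_combination 4 * hk⟩
  choose k hk using h
  exact ⟨k (c 0) + k (c 1) + k (c 2) + k (c 3), by
    simp only [sumSq, Fin.sum_univ_four, hk]; ring⟩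

/-- Two even and two odd entries, the even ones with sum `≡ 2 mod 4`. -/
lemma kleinDet_of_two_odd_of_odd {v : Fin 4 → ℤ} (c : Fin 4 → ℤ) (h0 : v 0 = 2 * c 0)
    (h1 : v 1 = 2 * c 1) (h2 : v 2 = 2 * c 2 + 1) (h3 : v 3 = 2 * c 3 + 1)
    (hc : Odd (c 0 + c 1)) : ∃ T, kleinDet v = 128 * T := by
  have sq : ∀ c : ℤ, Odd c → ∃ k, c ^ 2 = 8 * k + 1 := fun c hc => by
    obtain ⟨d, rfl⟩ := hc
    obtain ⟨k, hk⟩ := Int.even_mul_succ_self d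
    exact ⟨k, by linear_combination 4 * hk⟩
  rw [kleinDet_eq, h0, h1, h2, h3]
  obtain ⟨k1, hk1⟩ := sq _ hc
  obtain ⟨k2, hk2⟩ := sq (c 0 - c 1) (by rw [Int.odd_iff] at *; omega)
  -- Exactly one of `c 2 + c 3 + 1` and `c 2 - c 3` is odd; in its factor a difference of odd
  -- squares contributes `8` beyond the common `16`.
  rcases Int.even_or_odd (c 2 + c 3) with h | h
  · obtain ⟨k3, hk3⟩ := sq (c 2 + c 3 + 1) (by rw [Int.even_iff] at h; rw [Int.odd_iff]; omega)
    exact ⟨(k3 - k1) * ((c 2 - c 3) ^ 2 - (c 0 - c 1) ^ 2), by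
      linear_combination 16 * ((c 2 - c 3) ^ 2 - (c 0 - c 1) ^ 2) * (hk3 - hk1)⟩
  · obtain ⟨k3, hk3⟩ := sq (c 2 - c 3) (by rw [Int.odd_iff] at *; omega)
    exact ⟨(k3 - k2) * ((c 2 + c 3 + 1) ^ 2 - (c 0 + c 1) ^ 2), by
      linear_combination 16 * ((c 2 + c 3 + 1) ^ 2 - (c 0 + c 1) ^ 2) * (hk3 - hk2)⟩

/-- The factors `f = a² - b²` and `g = c² - d²` with `a` odd and `b` even. -/
lemma sq_sub_sq_factors {a b c d e : ℤ} (ha : Odd a) (hb : Even b) (he : 2 * e = b + 2 * d) :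
    a ^ 2 - b ^ 2 ≡ 1 [ZMOD 4] ∧ (4 ∣ c ^ 2 - d ^ 2 ∨
      c ^ 2 - d ^ 2 ≡ 1 [ZMOD 4] ∧ a ^ 2 - b ^ 2 ≡ 1 + 4 * e [ZMOD 8] ∨
      c ^ 2 - d ^ 2 ≡ 3 [ZMOD 4] ∧ a ^ 2 - b ^ 2 ≡ 5 + 4 * e [ZMOD 8]) := by
  obtain ⟨a, rfl⟩ := ha
  obtain ⟨b, rfl⟩ := hb
  obtain rfl : e = b + d := by omega
  obtain ⟨k, hk⟩ := Int.even_mul_succ_self a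
  obtain ⟨l, hl⟩ := Int.even_mul_succ_self b
  have hf : (2 * a + 1) ^ 2 - (b + b) ^ 2 = 8 * k + 1 + 4 * b - 8 * l := by
    linear_combination 4 * hk - 4 * hl
  rw [hf]
  refine ⟨by unfold Int.ModEq; omega, ?_⟩
  -- The first factor is `1 + 4 * b` mod `8` with `b = e - d`, and the parity of `d` decides between
  -- `1` and `3` mod `4` for an odd second factor.
  obtain ⟨c, rfl | rfl⟩ := Int.even_or_odd' c <;> obtain ⟨d, rfl | rfl⟩ := Int.even_or_odd' d
  · left; exact ⟨c ^ 2 - d ^ 2, by ring⟩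
  · right; right
    exact ⟨Int.modEq_iff_dvd.2 ⟨1 - c ^ 2 + d ^ 2 + d, by ring⟩, by unfold Int.ModEq; omega⟩
  · right; left
    exact ⟨Int.modEq_iff_dvd.2 ⟨-c ^ 2 - c + d ^ 2, by ring⟩, by unfold Int.ModEq; omega⟩
  · left; exact ⟨c ^ 2 + c - d ^ 2 - d, by ring⟩

/-- Two even and two odd entries, the even ones with sum `≡ 0 mod 4`. -/
lemma kleinDet_of_two_odd_of_even {v : Fin 4 → ℤ} (c : Fin 4 → ℤ) (h0 : v 0 = 2 * c 0)
    (h1 : v 1 = 2 * c 1) (h2 : v 2 = 2 * c 2 + 1) (h3 : v 3 = 2 * c 3 + 1)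
    (hc : Even (c 0 + c 1)) : ∃ f g, kleinDet v = 64 * (f * g) ∧ f ≡ 1 [ZMOD 4] ∧
      (4 ∣ g ∨ g ≡ 1 [ZMOD 4] ∧ f ≡ 1 + 4 * c 0 [ZMOD 8] ∨
        g ≡ 3 [ZMOD 4] ∧ f ≡ 5 + 4 * c 0 [ZMOD 8]) := by
  rw [kleinDet_eq, h0, h1, h2, h3]
  rw [Int.even_iff] at hc
  obtain ⟨d, hd⟩ : ∃ d, c 0 - c 1 = 2 * d := ⟨(c 0 - c 1) / 2, by omega⟩
  -- The factor whose odd-coordinate term is odd becomes `f`; the other yields `4 * g`. In either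
  -- case the half-sum `e` of `sq_sub_sq_factors` is `c 0`.
  rcases Int.even_or_odd (c 2 + c 3) with h | h
  · rw [Int.even_iff] at h
    obtain ⟨e, he⟩ : ∃ e, c 2 - c 3 = 2 * e := ⟨(c 2 - c 3) / 2, by omega⟩
    refine ⟨(c 2 + c 3 + 1) ^ 2 - (c 0 + c 1) ^ 2, e ^ 2 - d ^ 2, ?_,
      sq_sub_sq_factors (by rw [Int.odd_iff]; omega) (by rw [Int.even_iff]; omega) (by omega)⟩
    linear_combination 16 * ((c 2 + c 3 + 1) ^ 2 - (c 0 + c 1) ^ 2) *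
      ((c 2 - c 3 + 2 * e) * he - (c 0 - c 1 + 2 * d) * hd)
  · rw [Int.odd_iff] at h
    obtain ⟨e, he⟩ : ∃ e, c 2 + c 3 + 1 = 2 * e := ⟨(c 2 + c 3 + 1) / 2, by omega⟩
    obtain ⟨d', hd'⟩ : ∃ d', c 0 + c 1 = 2 * d' := ⟨(c 0 + c 1) / 2, by omega⟩
    refine ⟨(c 2 - c 3) ^ 2 - (c 0 - c 1) ^ 2, e ^ 2 - d' ^ 2, ?_,
      sq_sub_sq_factors (by rw [Int.odd_iff]; omega) (by rw [Int.even_iff]; omega) (by omega)⟩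
    linear_combination 16 * ((c 2 - c 3) ^ 2 - (c 0 - c 1) ^ 2) *
      ((c 2 + c 3 + 1 + 2 * e) * he - (c 0 + c 1 + 2 * d') * hd')

/-- The last clause feeds the parity count that excludes norm `2` for both quaternions. -/
lemma sumSq_of_two_odd {v : Fin 4 → ℤ} (c : Fin 4 → ℤ) (h0 : v 0 = 2 * c 0)
    (h1 : v 1 = 2 * c 1) (h2 : v 2 = 2 * c 2 + 1) (h3 : v 3 = 2 * c 3 + 1) :
    ∃ l : ℕ, sumSq v = 2 * l ∧ (l : ℤ) ≡ 1 + 2 * (c 0 + c 1) [ZMOD 4] ∧ (l = 1 → c 0 = 0) := by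
  have hs : sumSq v = 2 * (2 * (c 0 ^ 2 + c 1 ^ 2) + 2 * (c 2 ^ 2 + c 2) +
      2 * (c 3 ^ 2 + c 3) + 1) := by
    simp only [sumSq, Fin.sum_univ_four, h0, h1, h2, h3]; ring
  have hp : ∀ x : ℤ, 0 ≤ x ^ 2 + x := fun x => by
    rcases le_or_gt 0 x with h | h <;> nlinarith
  have i0 := sq_nonneg (c 0)
  have i1 := sq_nonneg (c 1)
  have i2 := hp (c 2)
  have i3 := hp (c 3)
  obtain ⟨k0, hk0⟩ := Int.even_mul_succ_self (c 0)
  obtain ⟨k1, hk1⟩ := Int.even_mul_succ_self (c 1)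
  obtain ⟨k2, hk2⟩ := Int.even_mul_succ_self (c 2)
  obtain ⟨k3, hk3⟩ := Int.even_mul_succ_self (c 3)
  refine ⟨(2 * (c 0 ^ 2 + c 1 ^ 2) + 2 * (c 2 ^ 2 + c 2) + 2 * (c 3 ^ 2 + c 3) + 1).toNat, ?_, ?_,
    fun h => ?_⟩
  · rw [Int.toNat_of_nonneg (by linarith)]; exact hs
  · rw [Int.toNat_of_nonneg (by linarith)]
    exact Int.modEq_iff_dvd.2 ⟨c 0 + c 1 - k0 - k1 - k2 - k3, by
      linear_combination -2 * (hk0 + hk1 + hk2 + hk3)⟩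
  · have : c 0 ^ 2 = 0 := by omega
    exact pow_eq_zero_iff (two_ne_zero) |>.1 this

end Necessity

/-! ### Necessity: combining the four parts under linkedness -/

section NecessityCases

variable {n : ℤ} {x y z t c₁ c₂ c₃ c₄ : Fin 4 → ℤ}

/-- Linked coordinates share the parity `ε i`, and divisibility of their sum by `4` becomes evenness
of the sum of the halves. -/
lemma exists_halves (h : ∀ i, Linked (x i) (y i) (z i) (t i)) :
    ∃ ε c₁ c₂ c₃ c₄ : Fin 4 → ℤ, Monotone ε ∧ (∀ i, ε i = 0 ∨ ε i = 1) ∧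
      (∀ i, Even (c₁ i + c₂ i + c₃ i + c₄ i)) ∧
      kleinDet x = kleinDet (fun i => 2 * c₁ i + ε i) ∧
      kleinDet y = kleinDet (fun i => 2 * c₂ i + ε i) ∧
      sumSq z = sumSq (fun i => 2 * c₃ i + ε i) ∧
      sumSq t = sumSq (fun i => 2 * c₄ i + ε i) := by
  obtain ⟨σ, hσ⟩ := exists_perm_sorted_parity x
  have h' := fun i => h (σ i)
  simp only [Linked] at h'
  refine ⟨fun i => x (σ i) % 2, fun i => x (σ i) / 2, fun i => y (σ i) / 2, fun i => z (σ i) / 2,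
    fun i => t (σ i) / 2, hσ, fun i => by dsimp only; omega, fun i => ?_, ?_, ?_, ?_, ?_⟩
  · have := h' i
    rw [Int.even_iff]
    dsimp only
    have e1 : y (σ i) % 2 = x (σ i) % 2 := by omega
    have e2 : z (σ i) % 2 = x (σ i) % 2 := by omega
    have e3 : t (σ i) % 2 = x (σ i) % 2 := by omega
    obtain ⟨-, j, hj⟩ := this
    omega
  · rw [← kleinDet_comp_perm x σ]
    congr 1; ext i; have := h' i; simp only [Function.comp_apply]; omega
  · rw [← kleinDet_comp_perm y σ]
    congr 1; ext i; have := h' i; simp only [Function.comp_apply]; omega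
  · rw [← sumSq_comp_perm z σ]
    congr 1; ext i; have := h' i; simp only [Function.comp_apply]; omega
  · rw [← sumSq_comp_perm t σ]
    congr 1; ext i; have := h' i; simp only [Function.comp_apply]; omega

/-- The condition on an odd group determinant `≡ 9 mod 16`. -/
def IsOddProduct (n : ℤ) : Prop := n ≡ 9 [ZMOD 16] ∧ ∃ (s₁ s₂ : ℤ) (l₁ l₂ : ℕ),
  n = s₁ * s₂ * ((l₁ : ℤ) * (l₂ : ℤ)) ^ 2 ∧
  s₁ ≡ -3 [ZMOD 8] ∧ s₂ ≡ -3 [ZMOD 8] ∧ l₁ ≡ 3 [MOD 4] ∧ l₂ ≡ 3 [MOD 4] ∧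
  ((s₁ ≡ s₂ [ZMOD 16] ∧ l₁ ≡ l₂ [MOD 8]) ∨ (s₁ ≡ s₂ + 8 [ZMOD 16] ∧ l₁ ≡ l₂ + 4 [MOD 8]))

lemma sumSq_nonneg (w : Fin 4 → ℤ) : 0 ≤ sumSq w := Finset.sum_nonneg fun _ _ => sq_nonneg _

/-- One odd coordinate. -/
lemma modEq_of_one_odd {ε : Fin 4 → ℤ} (h0 : ε 0 = 0) (h1 : ε 1 = 0) (h2 : ε 2 = 0)
    (h3 : ε 3 = 1) (hc : ∀ i, Even (c₁ i + c₂ i + c₃ i + c₄ i)) :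
    kleinDet (fun i => 2 * c₁ i + ε i) * kleinDet (fun i => 2 * c₂ i + ε i) *
      (sumSq (fun i => 2 * c₃ i + ε i) * sumSq (fun i => 2 * c₄ i + ε i)) ^ 2 ≡ 1 [ZMOD 16] := by
  have key := fun c : Fin 4 → ℤ => kleinDet_modEq_of_one_odd (v := fun i => 2 * c i + ε i) c
    (by simp [h0]) (by simp [h1]) (by simp [h2]) (by simp [h3])
  rw [mul_pow]
  refine (((key c₁).1.mul (key c₂).1).mul ((key c₃).2.mul (key c₄).2)).trans ?_
  have e : ∀ a b : ℤ, (1 + 8 * a) * (1 + 8 * b) ≡ 1 + 8 * (a + b) [ZMOD 16] := fun a b =>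
    Int.modEq_iff_dvd.2 ⟨-4 * a * b, by ring⟩
  refine ((e _ _).mul (e _ _)).trans ((e _ _).trans ?_)
  have i0 := hc 0
  have i1 := hc 1
  have i2 := hc 2
  rw [Int.even_iff] at i0 i1 i2
  unfold Int.ModEq
  omega

/-- Three odd coordinates. -/
lemma isOddProduct_of_three_odd {ε : Fin 4 → ℤ} (h0 : ε 0 = 0) (h1 : ε 1 = 1) (h2 : ε 2 = 1)
    (h3 : ε 3 = 1) (hc : ∀ i, Even (c₁ i + c₂ i + c₃ i + c₄ i)) :
    IsOddProduct (kleinDet (fun i => 2 * c₁ i + ε i) * kleinDet (fun i => 2 * c₂ i + ε i) *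
      (sumSq (fun i => 2 * c₃ i + ε i) * sumSq (fun i => 2 * c₄ i + ε i)) ^ 2) := by
  have key := fun c : Fin 4 → ℤ => kleinDet_modEq_of_three_odd (v := fun i => 2 * c i + ε i) c
    (by simp [h0]) (by simp [h1]) (by simp [h2]) (by simp [h3])
  have p1 := (key c₁).1
  have p2 := (key c₂).1
  have p3 := (key c₃).2
  have p4 := (key c₄).2
  obtain ⟨l, hl⟩ := Int.eq_ofNat_of_zero_le (sumSq_nonneg fun i => 2 * c₃ i + ε i)
  obtain ⟨l', hl'⟩ := Int.eq_ofNat_of_zero_le (sumSq_nonneg fun i => 2 * c₄ i + ε i)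
  rw [hl] at p3 ⊢
  rw [hl'] at p4 ⊢
  generalize kleinDet (fun i => 2 * c₁ i + ε i) = s₁ at *
  generalize kleinDet (fun i => 2 * c₂ i + ε i) = s₂ at *
  have i0 := hc 0
  rw [Int.even_iff] at i0
  refine ⟨?_, s₁, s₂, l, l', rfl, ?_⟩
  · have sq : ∀ (l : ℕ) (c : ℤ), (l : ℤ) ≡ 3 + 4 * c [ZMOD 8] →
        (l : ℤ) ^ 2 ≡ 9 + 8 * c [ZMOD 16] := fun l c h => by
      obtain ⟨k, hk⟩ := Int.modEq_iff_dvd.1 h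
      rw [show (l : ℤ) = 3 + 4 * c - 8 * k by linarith]
      exact Int.modEq_iff_dvd.2 ⟨-4 * k ^ 2 + 3 * k + 4 * c * k - c ^ 2 - c, by ring⟩
    rw [mul_pow]
    refine ((p1.mul p2).mul ((sq _ _ p3).mul (sq _ _ p4))).trans ?_
    obtain ⟨j, hj⟩ := Int.even_iff.2 i0
    have e1 : ∀ a b : ℤ, (-3 + 8 * a) * (-3 + 8 * b) ≡ 9 + 8 * (a + b) [ZMOD 16] := fun a b =>
      Int.modEq_iff_dvd.2 ⟨-4 * a * b + 2 * a + 2 * b, by ring⟩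
    have e2 : ∀ a b : ℤ, (9 + 8 * a) * (9 + 8 * b) ≡ 1 + 8 * (a + b) [ZMOD 16] := fun a b =>
      Int.modEq_iff_dvd.2 ⟨-4 * a * b - 5 - 4 * a - 4 * b, by ring⟩
    refine ((e1 _ _).mul (e2 _ _)).trans ?_
    exact Int.modEq_iff_dvd.2 ⟨-4 * (c₁ 0 + c₂ 0) * (c₃ 0 + c₄ 0) - 4 * (c₃ 0 + c₄ 0) - j, by
      linear_combination -8 * hj⟩
  -- The sums `c₁ 0 + c₂ 0` and `c₃ 0 + c₄ 0` have the same parity, which selects the same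
  -- alternative for the `s` and for the `l`.
  · simp only [← Int.natCast_modEq_iff]
    push_cast
    simp only [Int.ModEq] at *
    omega

/-- Zero or four odd coordinates. -/
lemma modEq_of_zero_or_four_odd {ε : Fin 4 → ℤ} (hε : (∀ i, ε i = 0) ∨ ∀ i, ε i = 1) :
    ∃ m, kleinDet (fun i => 2 * c₁ i + ε i) * kleinDet (fun i => 2 * c₂ i + ε i) *
      (sumSq (fun i => 2 * c₃ i + ε i) * sumSq (fun i => 2 * c₄ i + ε i)) ^ 2 = 2 ^ 16 * m ∧
      (m ≡ 1 [ZMOD 4] ∨ 4 ∣ m) := by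
  have e1 : ∀ {a b : ℤ}, a ≡ 1 [ZMOD 4] → b ≡ 1 [ZMOD 4] → a * b ≡ 1 [ZMOD 4] := fun h h' => by
    simpa using h.mul h'
  have odd_sq : ∀ l : ℤ, Odd l → l ^ 2 ≡ 1 [ZMOD 4] := fun l hl => by
    obtain ⟨k, rfl⟩ := hl
    exact Int.modEq_iff_dvd.2 ⟨-k ^ 2 - k, by ring⟩
  rcases hε with h | h
  · simp only [h, add_zero]
    have k1 : ∀ c : Fin 4 → ℤ, kleinDet (fun i => 2 * c i) = 16 * kleinDet c := fun c => by
      rw [kleinDet_eq, kleinDet_eq]; ring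
    have k2 : ∀ c : Fin 4 → ℤ, sumSq (fun i => 2 * c i) = 4 * sumSq c := fun c => by
      simp only [sumSq, Fin.sum_univ_four]; ring
    simp only [k1, k2]
    refine ⟨kleinDet c₁ * kleinDet c₂ * (sumSq c₃ * sumSq c₄) ^ 2, by ring, ?_⟩
    rcases kleinDet_emod_four c₁ with h1 | h1
    swap
    · exact Or.inr ((h1.mul_right _).mul_right _)
    rcases kleinDet_emod_four c₂ with h2 | h2
    swap
    · exact Or.inr ((h2.mul_left _).mul_right _)
    rcases Int.even_or_odd (sumSq c₃ * sumSq c₄) with h3 | h3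
    · exact Or.inr (((pow_dvd_pow_of_dvd (even_iff_two_dvd.1 h3) 2)).mul_left _)
    · exact Or.inl (e1 (e1 h1 h2) (odd_sq _ h3))
  · simp only [h]
    obtain ⟨P, hP, hP'⟩ := kleinDet_of_all_odd c₁
    obtain ⟨Q, hQ, hQ'⟩ := kleinDet_of_all_odd c₂
    obtain ⟨k, hk⟩ := sumSq_of_all_odd c₃
    obtain ⟨l, hl⟩ := sumSq_of_all_odd c₄
    rw [hP, hQ, hk, hl]
    refine ⟨P * Q * ((2 * k + 1) * (2 * l + 1)) ^ 2, by ring, ?_⟩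
    rcases hP' with h1 | h1
    swap
    · exact Or.inr ((h1.mul_right _).mul_right _)
    rcases hQ' with h2 | h2
    swap
    · exact Or.inr ((h2.mul_left _).mul_right _)
    exact Or.inl (e1 ((h1.mul h2).trans (by decide))
      (odd_sq _ ((odd_two_mul_add_one k).mul (odd_two_mul_add_one l))))

/-- The first three families of even group determinants. -/
def IsEvenFamily (n : ℤ) : Prop :=
  (∃ m : ℤ, n = 2 ^ 18 * m) ∨
  (∃ (m : ℤ) (p : ℕ), p.Prime ∧ p ≡ 3 [MOD 4] ∧ n = 2 ^ 17 * (2 * m + 1) * (p : ℤ) ^ 2) ∨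
  (∃ m : ℤ, (m ≡ 1 [ZMOD 8] ∨ m ≡ 3 [ZMOD 8] ∨ m ≡ 5 [ZMOD 8]) ∧ n = 2 ^ 16 * m)

lemma IsEvenFamily.of_modEq {m : ℤ} (h : m ≡ 1 [ZMOD 4] ∨ 4 ∣ m) : IsEvenFamily (2 ^ 16 * m) := by
  rcases h with h | ⟨k, rfl⟩
  · exact Or.inr (Or.inr ⟨m, by unfold Int.ModEq at *; omega, rfl⟩)
  · exact Or.inl ⟨k, by ring⟩

lemma exists_prime_dvd_modEq_three {l : ℕ} (hl : l % 4 = 3) :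
    ∃ p : ℕ, p.Prime ∧ p ≡ 3 [MOD 4] ∧ p ∣ l := by
  induction l using Nat.strong_induction_on with
  | _ l ih =>
    have hp := Nat.minFac_prime (n := l) (by omega)
    obtain ⟨k, hk⟩ := Nat.minFac_dvd l
    by_cases h : l.minFac % 4 = 3
    · exact ⟨_, hp, h, Nat.minFac_dvd l⟩
    · have hk4 : k % 4 = 3 := by
        have e : l.minFac * k % 4 = 3 := by rw [← hk]; exact hl
        rw [Nat.mul_mod] at e
        have a1 : l.minFac % 4 < 4 := Nat.mod_lt _ (by norm_num)
        have a2 : k % 4 < 4 := Nat.mod_lt _ (by norm_num)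
        generalize l.minFac % 4 = a at *
        generalize k % 4 = b at *
        interval_cases a <;> interval_cases b <;> omega
      obtain ⟨p, h1, h2, h3⟩ := ih k (by
        rw [hk]
        nlinarith [hp.two_le, show 0 < k by omega]) hk4
      exact ⟨p, h1, h2, hk ▸ h3.mul_left _⟩

lemma isEvenFamily_of_modEq_three {S : ℤ} {l l' : ℕ} (h : Odd (S * (l * l') ^ 2))
    (hl : (l : ℤ) % 4 = 3 ∨ (l' : ℤ) % 4 = 3) :
    IsEvenFamily (2 ^ 17 * (S * (l * l') ^ 2)) := by
  have hl3 : ∃ p : ℕ, p.Prime ∧ p ≡ 3 [MOD 4] ∧ p ∣ l * l' := by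
    rcases hl with hl | hl
    · obtain ⟨p, h1, h2, h3⟩ := exists_prime_dvd_modEq_three (l := l) (by omega)
      exact ⟨p, h1, h2, h3.mul_right _⟩
    · obtain ⟨p, h1, h2, h3⟩ := exists_prime_dvd_modEq_three (l := l') (by omega)
      exact ⟨p, h1, h2, h3.mul_left _⟩
  obtain ⟨p, h1, h2, k, hk⟩ := hl3
  have hk' : (l : ℤ) * l' = p * k := by exact_mod_cast hk
  rw [hk', show S * ((p : ℤ) * k) ^ 2 = S * k ^ 2 * p ^ 2 by ring] at h
  obtain ⟨m, hm⟩ := (Int.odd_mul.1 h).1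
  exact Or.inr (Or.inl ⟨m, p, h1, h2, by rw [hk', ← hm]; ring⟩)

/-- The four odd factors in the case of the determinants `2 ^ 16 * m`, `m ≡ 7 mod 8`. -/
lemma exists_factors_of_modEq_seven {f g f' g' L : ℤ} (hL : Odd L)
    (hm : f * g * (f' * g') * L ^ 2 ≡ 7 [ZMOD 8]) (hf : f ≡ 1 [ZMOD 4]) (hf' : f' ≡ 1 [ZMOD 4]) :
    (∃ s k, f * g * (f' * g') * L ^ 2 = (8 * s + 3) * (8 * k - 3)) ∨
      f ≡ 1 [ZMOD 8] ∧ f' ≡ 1 [ZMOD 8] ∧ f * g * (f' * g') ≡ 7 [ZMOD 8] := by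
  have hL2 : L ^ 2 ≡ 1 [ZMOD 8] := by
    obtain ⟨k, rfl⟩ := hL
    obtain ⟨j, hj⟩ := Int.even_mul_succ_self k
    exact Int.modEq_iff_dvd.2 ⟨-j, by linear_combination -4 * hj⟩
  have split : ∀ u v : ℤ, u ≡ 5 [ZMOD 8] → u * v ≡ 7 [ZMOD 8] →
      ∃ s k, u * v = (8 * s + 3) * (8 * k - 3) := by
    intro u v hu huv
    have hv : v ≡ 3 [ZMOD 8] := by
      have i1 := (hu.mul_right v).symm.trans huv
      unfold Int.ModEq at *
      omega
    obtain ⟨k, hk⟩ := Int.modEq_iff_dvd.1 hu.symm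
    obtain ⟨s, hs⟩ := Int.modEq_iff_dvd.1 hv.symm
    exact ⟨s, k + 1, by rw [show v = 8 * s + 3 by linarith,
      show u = 8 * (k + 1) - 3 by linarith]; ring⟩
  have hm' : f * g * (f' * g') ≡ 7 [ZMOD 8] := by
    simpa using ((hL2.mul_left (f * g * (f' * g'))).symm.trans hm)
  by_cases h1 : f ≡ 5 [ZMOD 8]
  · left
    obtain ⟨s, k, e⟩ := split f (g * (f' * g') * L ^ 2) h1 (by convert hm using 1; ring)
    exact ⟨s, k, by rw [← e]; ring⟩
  by_cases h2 : f' ≡ 5 [ZMOD 8]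
  · left
    obtain ⟨s, k, e⟩ := split f' (f * g * g' * L ^ 2) h2 (by convert hm using 1; ring)
    exact ⟨s, k, by rw [← e]; ring⟩
  right
  refine ⟨?_, ?_, hm'⟩ <;> unfold Int.ModEq at * <;> omega

/-- The last two families of even group determinants, with the additional information that the
first of the two forms does not come from `l = l' = 2`. -/
def IsSevenFamily (n l l' : ℤ) : Prop := ∃ m : ℤ, m ≡ 7 [ZMOD 8] ∧ n = 2 ^ 16 * m ∧
  ((∃ (t : ℤ) (l : ℕ), l ≡ 1 [MOD 4] ∧ 5 ≤ l ∧ n = 2 ^ 16 * (8 * t - 1) * (l : ℤ) ^ 2) ∧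
      ¬ (l = 2 ∧ l' = 2) ∨
    (∃ t k : ℤ, n = 2 ^ 16 * ((8 * t + 3) * (8 * k - 3))))

lemma isSevenFamily_of_factors {f g f' g' e₁ e₂ e₃ e₄ : ℤ} {l l' : ℕ}
    (hm : f * g * (f' * g') * (l * l') ^ 2 ≡ 7 [ZMOD 8]) (hf : f ≡ 1 [ZMOD 4])
    (hf' : f' ≡ 1 [ZMOD 4])
    (hg1 : f ≡ 1 + 4 * e₁ [ZMOD 8]) (hg2 : f' ≡ 5 + 4 * e₂ [ZMOD 8])
    (he : Even (e₁ + e₂ + e₃ + e₄)) (h1 : l = 1 → e₃ = 0) (h2 : l' = 1 → e₄ = 0)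
    (hll : (l : ℤ) * l' ≡ 1 [ZMOD 4]) :
    IsSevenFamily (2 ^ 16 * (f * g * (f' * g') * (l * l') ^ 2)) (2 * l) (2 * l') := by
  refine ⟨_, hm, rfl, ?_⟩
  rcases exists_factors_of_modEq_seven (Int.odd_iff.2 (by unfold Int.ModEq at hll; omega)) hm
    hf hf' with ⟨s, k, e⟩ | ⟨k1, k2, k3⟩
  · exact Or.inr ⟨s, k, by rw [e]⟩
  -- Here `f ≡ f' ≡ 1 mod 8` makes `e₁` even and `e₂` odd, so `e₃` and `e₄` cannot both vanish.
  have hne : ¬ (l = 1 ∧ l' = 1) := by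
    rintro ⟨h, h'⟩
    have e3 := h1 h
    have e4 := h2 h'
    rw [Int.even_iff] at he
    unfold Int.ModEq at *
    omega
  refine Or.inl ⟨?_, fun h => hne (by omega)⟩
  obtain ⟨s, hs⟩ := Int.modEq_iff_dvd.1 k3.symm
  refine ⟨s + 1, l * l', (Int.natCast_modEq_iff).1 (by exact_mod_cast hll), ?_, ?_⟩
  · have hll' : l * l' ≡ 1 [MOD 4] := (Int.natCast_modEq_iff).1 (by exact_mod_cast hll)
    unfold Nat.ModEq at hll'
    have : l * l' ≠ 1 := fun h => hne (mul_eq_one.1 h)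
    omega
  · rw [show f * g * (f' * g') = 8 * s + 7 by linarith]
    push_cast
    ring

/-- Two odd coordinates. -/
lemma isEvenFamily_or_of_two_odd {ε : Fin 4 → ℤ} (h0 : ε 0 = 0) (h1 : ε 1 = 0) (h2 : ε 2 = 1)
    (h3 : ε 3 = 1) (hc : ∀ i, Even (c₁ i + c₂ i + c₃ i + c₄ i)) :
    IsEvenFamily (kleinDet (fun i => 2 * c₁ i + ε i) * kleinDet (fun i => 2 * c₂ i + ε i) *
      (sumSq (fun i => 2 * c₃ i + ε i) * sumSq (fun i => 2 * c₄ i + ε i)) ^ 2) ∨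
    IsSevenFamily (kleinDet (fun i => 2 * c₁ i + ε i) * kleinDet (fun i => 2 * c₂ i + ε i) *
      (sumSq (fun i => 2 * c₃ i + ε i) * sumSq (fun i => 2 * c₄ i + ε i)) ^ 2)
      (sumSq (fun i => 2 * c₃ i + ε i)) (sumSq (fun i => 2 * c₄ i + ε i)) := by
  have keyO := fun c : Fin 4 → ℤ => kleinDet_of_two_odd_of_odd (v := fun i => 2 * c i + ε i) c
    (by simp [h0]) (by simp [h1]) (by simp [h2]) (by simp [h3])
  have keyE := fun c : Fin 4 → ℤ => kleinDet_of_two_odd_of_even (v := fun i => 2 * c i + ε i) c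
    (by simp [h0]) (by simp [h1]) (by simp [h2]) (by simp [h3])
  have keyN := fun c : Fin 4 → ℤ => sumSq_of_two_odd (v := fun i => 2 * c i + ε i) c
    (by simp [h0]) (by simp [h1]) (by simp [h2]) (by simp [h3])
  obtain ⟨l, hl, hl4, hl1⟩ := keyN c₃
  obtain ⟨l', hl', hl4', hl1'⟩ := keyN c₄
  have i0 := hc 0
  have i1 := hc 1
  rw [hl, hl']
  rw [Int.even_iff] at i0 i1
  unfold Int.ModEq at hl4 hl4'
  have hlodd : Odd ((l * l' : ℤ) ^ 2) :=
    ((Int.odd_iff.2 (by omega)).mul (Int.odd_iff.2 (by omega))).pow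
  -- When only one of the even parts has an odd half-sum, linkedness gives the odd parts half-sums
  -- of opposite parity, so one of `l, l'` is `3` mod `4`.
  have mixed : ∀ S T : ℤ, ((l : ℤ) % 4 = 3 ∨ (l' : ℤ) % 4 = 3) →
      IsEvenFamily (64 * S * (128 * T) * (2 * l * (2 * l')) ^ 2) := fun S T h3 => by
    rcases Int.even_or_odd (S * T) with h | h
    · obtain ⟨k, hk⟩ := h
      exact Or.inl ⟨k * (l * l') ^ 2, by linear_combination 2 ^ 17 * (l * l' : ℤ) ^ 2 * hk⟩
    · convert isEvenFamily_of_modEq_three (h.mul hlodd) h3 using 1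
      ring
  rcases Int.even_or_odd (c₁ 0 + c₁ 1) with hx | hx <;>
    rcases Int.even_or_odd (c₂ 0 + c₂ 1) with hy | hy
  · obtain ⟨f, g, e, hf, hg⟩ := keyE c₁ hx
    obtain ⟨f', g', e', hf', hg'⟩ := keyE c₂ hy
    rw [e, e', show 64 * (f * g) * (64 * (f' * g')) * (2 * (l : ℤ) * (2 * l')) ^ 2 =
      2 ^ 16 * (f * g * (f' * g') * (l * l') ^ 2) by ring]
    rcases hg with ⟨k, rfl⟩ | hg
    · exact Or.inl (.of_modEq (Or.inr ⟨f * k * (f' * g') * (l * l') ^ 2, by ring⟩))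
    rcases hg' with ⟨k, rfl⟩ | hg'
    · exact Or.inl (.of_modEq (Or.inr ⟨f * g * (f' * k) * (l * l') ^ 2, by ring⟩))
    by_cases hm : f * g * (f' * g') * (l * l') ^ 2 ≡ 7 [ZMOD 8]
    swap
    · refine Or.inl (Or.inr (Or.inr ⟨_, ?_, rfl⟩))
      have ho : Odd (f * g * (f' * g') * (l * l') ^ 2) := by
        refine (((Int.odd_iff.2 ?_).mul (Int.odd_iff.2 ?_)).mul ((Int.odd_iff.2 ?_).mul
          (Int.odd_iff.2 ?_))).mul hlodd <;> unfold Int.ModEq at * <;> omega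
      rw [Int.odd_iff] at ho
      unfold Int.ModEq at *
      omega
    right
    have hll : (l : ℤ) * l' ≡ 1 [ZMOD 4] := by
      rw [Int.even_iff] at hx hy
      have : (l : ℤ) % 4 = 1 ∧ (l' : ℤ) % 4 = 1 ∨ (l : ℤ) % 4 = 3 ∧ (l' : ℤ) % 4 = 3 := by omega
      unfold Int.ModEq
      rw [Int.mul_emod]
      rcases this with ⟨h, h'⟩ | ⟨h, h'⟩ <;> rw [h, h'] <;> rfl
    have hodd : f * g * (f' * g') * (l * l') ^ 2 ≡ g * g' [ZMOD 4] := by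
      have := ((hf.mul (Int.ModEq.refl g)).mul (hf'.mul (Int.ModEq.refl g'))).mul (hll.pow 2)
      simpa using this
    -- Since `g * g' ≡ 3 mod 4`, exactly one of `g, g'` is `3` mod `4`.
    have hgg := hodd.symm.trans (hm.of_dvd (by norm_num : (4 : ℤ) ∣ 8))
    rcases hg with ⟨hg, k⟩ | ⟨hg, k⟩ <;> rcases hg' with ⟨hg', k'⟩ | ⟨hg', k'⟩
    · exact absurd ((hg.mul hg').symm.trans hgg) (by decide)
    · exact isSevenFamily_of_factors hm hf hf' k k' (hc 0) hl1 hl1' hll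
    · have := isSevenFamily_of_factors (f := f') (g := g') (f' := f) (g' := g) (l := l) (l' := l')
        (by convert hm using 1; ring) hf' hf k' k
        (by convert hc 0 using 1; ring) hl1 hl1' hll
      convert this using 1
      ring
    · exact absurd ((hg.mul hg').symm.trans hgg) (by decide)
  · obtain ⟨f, g, e, -⟩ := keyE c₁ hx
    obtain ⟨T, hT⟩ := keyO c₂ hy
    rw [e, hT]
    rw [Int.even_iff] at hx
    rw [Int.odd_iff] at hy
    exact Or.inl (mixed _ _ (by omega))
  · obtain ⟨f, g, e, -⟩ := keyE c₂ hy
    obtain ⟨T, hT⟩ := keyO c₁ hx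
    rw [e, hT, mul_comm (128 * T)]
    rw [Int.even_iff] at hy
    rw [Int.odd_iff] at hx
    exact Or.inl (mixed _ _ (by omega))
  · obtain ⟨T, hT⟩ := keyO c₁ hx
    obtain ⟨T', hT'⟩ := keyO c₂ hy
    rw [hT, hT']
    exact Or.inl (Or.inl ⟨T * T' * (l * l') ^ 2, by ring⟩)

/-- Every value of the determinant formula belongs to one of the families. -/
theorem families_of_linked (h : ∀ i, Linked (x i) (y i) (z i) (t i))
    (hn : n = kleinDet x * kleinDet y * (sumSq z * sumSq t) ^ 2) :
    (Odd n ∧ (n ≡ 1 [ZMOD 16] ∨ IsOddProduct n)) ∨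
      (Even n ∧ (IsEvenFamily n ∨ IsSevenFamily n (sumSq z) (sumSq t))) := by
  obtain ⟨ε, c₁, c₂, c₃, c₄, hε, h01, hc, e1, e2, e3, e4⟩ := exists_halves h
  rw [e1, e2, e3, e4] at hn
  rw [e3, e4]
  have m0 := hε (show (0 : Fin 4) ≤ 1 by decide)
  have m1 := hε (show (1 : Fin 4) ≤ 2 by decide)
  have m2 := hε (show (2 : Fin 4) ≤ 3 by decide)
  have even_of : (∃ m, n = 2 ^ 16 * m) → Even n := by
    rintro ⟨m, rfl⟩
    exact ⟨2 ^ 15 * m, by ring⟩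
  have family_dvd : IsEvenFamily n ∨ IsSevenFamily n (sumSq fun i => 2 * c₃ i + ε i)
      (sumSq fun i => 2 * c₄ i + ε i) → ∃ m, n = 2 ^ 16 * m := by
    rintro ((⟨m, e⟩ | ⟨m, p, -, -, e⟩ | ⟨m, -, e⟩) | ⟨m, -, e, -⟩)
    · exact ⟨4 * m, by rw [e]; ring⟩
    · exact ⟨2 * ((2 * m + 1) * p ^ 2), by rw [e]; ring⟩
    · exact ⟨m, e⟩
    · exact ⟨m, e⟩
  have odd_of : ∀ r : ℤ, r % 2 = 1 → n ≡ r [ZMOD 16] → Odd n := fun r hr hnr => by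
    rw [Int.odd_iff]
    unfold Int.ModEq at hnr
    omega
  -- Monotonicity of `ε` leaves five of the sixteen parity patterns.
  rcases h01 0 with z0 | z0 <;> rcases h01 1 with z1 | z1 <;> rcases h01 2 with z2 | z2 <;>
    rcases h01 3 with z3 | z3 <;> try omega
  · obtain ⟨m, hm, hm'⟩ := modEq_of_zero_or_four_odd (c₁ := c₁) (c₂ := c₂) (c₃ := c₃) (c₄ := c₄)
      (Or.inl fun i => by fin_cases i <;> assumption : (∀ i, ε i = 0) ∨ ∀ i, ε i = 1)
    rw [← hn] at hm
    exact Or.inr ⟨even_of ⟨m, hm⟩, Or.inl (hm ▸ .of_modEq hm')⟩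
  · have := modEq_of_one_odd z0 z1 z2 z3 hc
    rw [← hn] at this
    exact Or.inl ⟨odd_of 1 rfl this, Or.inl this⟩
  · have := isEvenFamily_or_of_two_odd z0 z1 z2 z3 hc
    rw [← hn] at this
    exact Or.inr ⟨even_of (family_dvd this), this⟩
  · have := isOddProduct_of_three_odd z0 z1 z2 z3 hc
    rw [← hn] at this
    exact Or.inl ⟨odd_of 9 rfl this.1, Or.inr this⟩
  · obtain ⟨m, hm, hm'⟩ := modEq_of_zero_or_four_odd (c₁ := c₁) (c₂ := c₂) (c₃ := c₃) (c₄ := c₄)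
      (Or.inr fun i => by fin_cases i <;> assumption : (∀ i, ε i = 0) ∨ ∀ i, ε i = 1)
    rw [← hn] at hm
    exact Or.inr ⟨even_of ⟨m, hm⟩, Or.inl (hm ▸ .of_modEq hm')⟩

end NecessityCases

/-! ### Sufficiency: explicit linked quadruples -/

section Constructions

/-- Where all four coordinates are odd, they are linked up to a sign. -/
lemma mem_integerGroupDets_of_linked_or_odd {x y z w : Fin 4 → ℤ}
    (h : ∀ i, Linked (x i) (y i) (z i) (w i) ∨
      x i % 2 = 1 ∧ y i % 2 = 1 ∧ z i % 2 = 1 ∧ w i % 2 = 1) :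
    kleinDet x * kleinDet y * (sumSq z * sumSq w) ^ 2 ∈ integerGroupDets Z2Q8 := by
  have key : ∀ i, ∃ t, Linked (x i) (y i) (z i) t ∧ t ^ 2 = w i ^ 2 := fun i => by
    rcases h i with h | h
    · exact ⟨_, h, rfl⟩
    · by_cases h' : 4 ∣ x i + y i + z i + w i
      · exact ⟨w i, by unfold Linked; omega, rfl⟩
      · exact ⟨-w i, by unfold Linked; omega, neg_sq _⟩
  choose t ht ht' using key
  have : sumSq w = sumSq t := Finset.sum_congr rfl fun i _ => (ht' i).symm
  rw [this]
  exact mem_integerGroupDets_of_linked ht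

lemma sq_emod_eight (x : ℤ) :
    x % 2 = 1 ∧ x ^ 2 % 8 = 1 ∨ x % 4 = 0 ∧ x ^ 2 % 8 = 0 ∨ x % 4 = 2 ∧ x ^ 2 % 8 = 4 := by
  have h : x ^ 2 % 8 = (x % 8) ^ 2 % 8 := by rw [pow_two, pow_two, Int.mul_emod]
  have h8 : x % 8 = 0 ∨ x % 8 = 1 ∨ x % 8 = 2 ∨ x % 8 = 3 ∨ x % 8 = 4 ∨ x % 8 = 5 ∨ x % 8 = 6 ∨
      x % 8 = 7 := by omega
  rcases h8 with e | e | e | e | e | e | e | e <;> rw [e] at h <;> norm_num at h <;> omega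

/-- Four squares with sum `≡ 3 mod 4`. -/
lemma exists_sumSq_of_three {l : ℕ} (hl : l % 4 = 3) :
    ∃ w : Fin 4 → ℤ, sumSq w = l ∧ w 0 % 2 = 0 ∧ w 1 % 2 = 1 ∧ w 2 % 2 = 1 ∧ w 3 % 2 = 1 ∧
      (l : ℤ) % 8 = (3 + 2 * w 0) % 8 := by
  obtain ⟨a, b, c, d, h⟩ := Nat.sum_four_squares l
  obtain ⟨σ, hσ⟩ := exists_perm_sorted_parity ![(a : ℤ), b, c, d]
  have hs := sumSq_comp_perm ![(a : ℤ), b, c, d] σ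
  have hl' : sumSq ![(a : ℤ), b, c, d] = l := by
    rw [← h]; simp [sumSq, Fin.sum_univ_four]
  rw [hl'] at hs
  generalize hw : ![(a : ℤ), b, c, d] ∘ σ = w at hs
  have hm : Monotone fun i => w i % 2 := by rw [← hw]; exact hσ
  have m0 := hm (show (0 : Fin 4) ≤ 1 by decide)
  have m1 := hm (show (1 : Fin 4) ≤ 2 by decide)
  have m2 := hm (show (2 : Fin 4) ≤ 3 by decide)
  refine ⟨w, hs, ?_⟩
  rw [sumSq, Fin.sum_univ_four] at hs
  dsimp only at m0 m1 m2
  have h0 := sq_emod_eight (w 0)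
  have h1 := sq_emod_eight (w 1)
  have h2 := sq_emod_eight (w 2)
  have h3 := sq_emod_eight (w 3)
  omega

/-- Four squares with sum `≡ 2 mod 4`, one of which may be prescribed to be even. -/
lemma exists_sumSq_sorted {a b c d n : ℤ} (h : a ^ 2 + b ^ 2 + c ^ 2 + d ^ 2 = n)
    (hn : n % 4 = 2) (ha : a % 2 = 0) :
    ∃ w : Fin 4 → ℤ, sumSq w = n ∧ w 0 = a ∧ w 1 % 2 = 0 ∧ w 2 % 2 = 1 ∧ w 3 % 2 = 1 := by
  have h0 := sq_emod_eight a
  have h1 := sq_emod_eight b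
  have h2 := sq_emod_eight c
  have h3 := sq_emod_eight d
  by_cases hb : b % 2 = 0
  · refine ⟨![a, b, c, d], by simpa [sumSq, Fin.sum_univ_four] using h, rfl, hb, ?_, ?_⟩ <;>
      simp <;> omega
  by_cases hc : c % 2 = 0
  · refine ⟨![a, c, b, d], ?_, rfl, hc, ?_, ?_⟩
    · simp [sumSq, Fin.sum_univ_four]; linarith
    all_goals simp; omega
  · refine ⟨![a, d, b, c], ?_, rfl, ?_, ?_, ?_⟩
    · simp [sumSq, Fin.sum_univ_four]; linarith
    all_goals simp; omega

lemma exists_sumSq_of_six {l : ℕ} (hl : l % 4 = 3) :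
    ∃ w : Fin 4 → ℤ, sumSq w = 2 * l ∧ w 0 % 4 = 2 ∧ w 1 % 4 = 0 ∧ w 2 % 2 = 1 ∧ w 3 % 2 = 1 := by
  obtain ⟨a, b, c, d, h⟩ := Nat.sum_four_squares (2 * l)
  zify at h
  have main : ∀ a b c d : ℤ, a ^ 2 + b ^ 2 + c ^ 2 + d ^ 2 = 2 * l → a % 4 = 2 →
      ∃ w : Fin 4 → ℤ, sumSq w = 2 * l ∧ w 0 % 4 = 2 ∧ w 1 % 4 = 0 ∧ w 2 % 2 = 1 ∧
        w 3 % 2 = 1 := fun a b c d h ha => by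
    obtain ⟨w, hw, h0, h1, h2, h3⟩ := exists_sumSq_sorted h (by omega) (by omega)
    refine ⟨w, hw, h0 ▸ ha, ?_, h2, h3⟩
    -- Since `2 * l ≡ 6 mod 8` and the odd squares contribute `2`, the even squares sum to `4` mod
    -- `8`.
    rw [sumSq, Fin.sum_univ_four] at hw
    have h0 := sq_emod_eight (w 0)
    have h1 := sq_emod_eight (w 1)
    have h2 := sq_emod_eight (w 2)
    have h3 := sq_emod_eight (w 3)
    omega
  have h0 := sq_emod_eight a
  have h1 := sq_emod_eight b
  have h2 := sq_emod_eight c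
  have h3 := sq_emod_eight d
  have : (a : ℤ) % 4 = 2 ∨ (b : ℤ) % 4 = 2 ∨ (c : ℤ) % 4 = 2 ∨ (d : ℤ) % 4 = 2 := by omega
  rcases this with e | e | e | e
  · exact main a b c d h e
  · exact main b a c d (by linarith) e
  · exact main c a b d (by linarith) e
  · exact main d a b c (by linarith) e

lemma exists_sumSq_of_ten {l : ℕ} (hl : l % 4 = 1) (h5 : 5 ≤ l) :
    ∃ w : Fin 4 → ℤ, sumSq w = 2 * l ∧ w 0 % 4 = 2 ∧ w 1 % 4 = 2 ∧ w 2 % 2 = 1 ∧ w 3 % 2 = 1 := by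
  -- The entry `2` is prescribed; the remaining sum `2 * l - 4 ≡ 6 mod 8` forces the other even
  -- entry to be `2` mod `4`.
  obtain ⟨a, b, c, h⟩ := exists_sum_three_squares (n := 2 * l - 4) (by omega)
  rw [Nat.cast_sub (by omega)] at h
  push_cast at h
  obtain ⟨w, hw, h0, h1, h2, h3⟩ := exists_sumSq_sorted (a := 2) (b := a) (c := b) (d := c)
    (n := 2 * l) (by linarith) (by omega) rfl
  refine ⟨w, hw, by rw [h0]; rfl, ?_, h2, h3⟩
  rw [sumSq, Fin.sum_univ_four, h0] at hw
  have h1 := sq_emod_eight (w 1)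
  have h2 := sq_emod_eight (w 2)
  have h3 := sq_emod_eight (w 3)
  omega

lemma mem_of_modEq_one {n : ℤ} (hn : n ≡ 1 [ZMOD 16]) : n ∈ integerGroupDets Z2Q8 := by
  obtain ⟨j, hj⟩ := Int.modEq_iff_dvd.1 hn.symm
  have := mem_integerGroupDets_of_linked (x := ![4 * j + 1, 4 * j, 4 * j, 4 * j])
    (y := ![1, 0, 0, 0]) (z := ![1, 0, 0, 0]) (t := ![1, 0, 0, 0])
    (fun i => by fin_cases i <;> simp [Linked] <;> omega)
  convert this using 1
  simp [kleinDet_eq, sumSq, Fin.sum_univ_four]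
  linear_combination hj

lemma mem_of_isOddProduct {n : ℤ} (hn : IsOddProduct n) : n ∈ integerGroupDets Z2Q8 := by
  obtain ⟨-, s₁, s₂, l₁, l₂, rfl, h1, h2, h3, h4, h5⟩ := hn
  obtain ⟨k, hk⟩ := Int.modEq_iff_dvd.1 h1
  obtain ⟨k', hk'⟩ := Int.modEq_iff_dvd.1 h2
  obtain ⟨z, hz, z0, z1, z2, z3, z4⟩ := exists_sumSq_of_three h3
  obtain ⟨w, hw, w0, w1, w2, w3, w4⟩ := exists_sumSq_of_three h4
  have hd : ∀ k : ℤ, kleinDet ![2 * k, 2 * k + 1, 2 * k + 1, 2 * k + 1] = -3 - 8 * k := fun k => by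
    simp [kleinDet_eq]; ring
  have := mem_integerGroupDets_of_linked_or_odd (x := ![2 * k, 2 * k + 1, 2 * k + 1, 2 * k + 1])
    (y := ![2 * k', 2 * k' + 1, 2 * k' + 1, 2 * k' + 1]) (z := z) (w := w) (fun i => by
      simp only [Int.ModEq, Nat.ModEq] at *
      fin_cases i
      · left; simp [Linked]; omega
      all_goals right; simp; omega)
  rw [hd, hd, hz, hw] at this
  convert this using 4 <;> linarith

lemma mem_two_pow_eighteen (m : ℤ) : 2 ^ 18 * m ∈ integerGroupDets Z2Q8 := by
  -- The values of `kleinDet` are `128 * m` and `128`; the parity of `m` decides the order in which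
  -- the even entries of `y` are linked to those of `x`.
  rcases Int.even_or_odd m with h | h
  · rw [Int.even_iff] at h
    have := mem_integerGroupDets_of_linked_or_odd (x := ![-2 * m, -2 * m - 2, 1 - 2 * m, 1 - 2 * m])
      (y := ![-4, -2, -1, -1]) (z := ![0, 0, 1, 1]) (w := ![0, 0, 1, 1]) (fun i => by
        fin_cases i <;> simp [Linked] <;> omega)
    convert this using 1
    simp [kleinDet_eq, sumSq, Fin.sum_univ_four]
    ring
  · rw [Int.odd_iff] at h
    have := mem_integerGroupDets_of_linked_or_odd (x := ![-2 * m, -2 * m - 2, 1 - 2 * m, 1 - 2 * m])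
      (y := ![-2, -4, -1, -1]) (z := ![0, 0, 1, 1]) (w := ![0, 0, 1, 1]) (fun i => by
        fin_cases i <;> simp [Linked] <;> omega)
    convert this using 1
    simp [kleinDet_eq, sumSq, Fin.sum_univ_four]
    ring

lemma mem_two_pow_seventeen (m : ℤ) {p : ℕ} (hp : p % 4 = 3) :
    2 ^ 17 * (2 * m + 1) * (p : ℤ) ^ 2 ∈ integerGroupDets Z2Q8 := by
  obtain ⟨w, hw, w0, w1, w2, w3⟩ := exists_sumSq_of_six hp
  -- The values of `kleinDet` are `64` and `128 * (2 * m + 1)`; the even entries of `y` are `2` and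
  -- `0` mod `4`, matching those of `w`.
  have := mem_integerGroupDets_of_linked_or_odd (x := ![0, 0, 3, -1])
    (y := ![-2 * (2 * m + 1), -2 * (2 * m + 1) - 2, 1 - 2 * (2 * m + 1), 1 - 2 * (2 * m + 1)])
    (z := ![0, 0, 1, 1]) (w := w) (fun i => by fin_cases i <;> simp [Linked] <;> omega)
  convert this using 1
  rw [hw]
  simp [kleinDet_eq, sumSq, Fin.sum_univ_four]
  ring

lemma mem_of_modEq_one_four (k : ℤ) : 2 ^ 16 * (4 * k + 1) ∈ integerGroupDets Z2Q8 := by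
  have := mem_integerGroupDets_of_linked_or_odd (x := ![4 * k, -(4 * k), 4 * k + 3, -(4 * k) - 1]) (y := ![0, 0, 3, -1])
    (z := ![0, 0, 1, 1]) (w := ![0, 0, 1, 1]) (fun i => by
      fin_cases i <;> simp [Linked] <;> omega)
  convert this using 1
  simp [kleinDet_eq, sumSq, Fin.sum_univ_four]
  ring

/-- The two values of `kleinDet` are `64 * (4 * k + 1)` and `64 * (8 * t + 3)`, with all even
entries divisible by `4`. -/
lemma mem_mul_three (t k : ℤ) :
    2 ^ 16 * ((8 * t + 3) * (4 * k + 1)) ∈ integerGroupDets Z2Q8 := by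
  have := mem_integerGroupDets_of_linked_or_odd (x := ![4 * k, -(4 * k), 4 * k + 3, -(4 * k) - 1])
    (y := ![4 * t + 4, 4 * t, 4 * t + 1, 4 * t + 1])
    (z := ![0, 0, 1, 1]) (w := ![0, 0, 1, 1]) (fun i => by
      fin_cases i <;> simp [Linked] <;> omega)
  convert this using 1
  simp [kleinDet_eq, sumSq, Fin.sum_univ_four]
  ring

lemma mem_mul_sq (t : ℤ) {l : ℕ} (hl : l % 4 = 1) (h5 : 5 ≤ l) :
    2 ^ 16 * (8 * t - 1) * (l : ℤ) ^ 2 ∈ integerGroupDets Z2Q8 := by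
  obtain ⟨w, hw, w0, w1, w2, w3⟩ := exists_sumSq_of_ten hl h5
  -- The value `64 * (8 * t - 1)` comes from a `y` with both even entries `2` mod `4`, which is why
  -- `w` needs the same.
  have := mem_integerGroupDets_of_linked_or_odd (x := ![0, 0, 3, -1])
    (y := ![4 * t + 2, 4 * t - 2, 4 * t - 1, 4 * t - 1])
    (z := ![0, 0, 1, 1]) (w := w) (fun i => by fin_cases i <;> simp [Linked] <;> omega)
  convert this using 1
  rw [hw]
  simp [kleinDet_eq, sumSq, Fin.sum_univ_four]
  ring

end Constructions

theorem mainTheorem4 :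
    -- the odd integer group determinants
    {n : ℤ | n ∈ integerGroupDets Z2Q8 ∧ Odd n} =
      {n : ℤ | n ≡ 1 [ZMOD 16]} ∪
      {n : ℤ | n ≡ 9 [ZMOD 16] ∧ ∃ (s₁ s₂ : ℤ) (l₁ l₂ : ℕ),
        n = s₁ * s₂ * ((l₁ : ℤ) * (l₂ : ℤ)) ^ 2 ∧
        s₁ ≡ -3 [ZMOD 8] ∧ s₂ ≡ -3 [ZMOD 8] ∧ l₁ ≡ 3 [MOD 4] ∧ l₂ ≡ 3 [MOD 4] ∧
        ((s₁ ≡ s₂ [ZMOD 16] ∧ l₁ ≡ l₂ [MOD 8]) ∨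
          (s₁ ≡ s₂ + 8 [ZMOD 16] ∧ l₁ ≡ l₂ + 4 [MOD 8]))} ∧
    -- the even integer group determinants
    {n : ℤ | n ∈ integerGroupDets Z2Q8 ∧ Even n} =
      {n : ℤ | ∃ m : ℤ, n = 2 ^ 18 * m} ∪
      {n : ℤ | ∃ (m : ℤ) (p : ℕ), p.Prime ∧ p ≡ 3 [MOD 4] ∧
        n = 2 ^ 17 * (2 * m + 1) * (p : ℤ) ^ 2} ∪
      {n : ℤ | ∃ m : ℤ, (m ≡ 1 [ZMOD 8] ∨ m ≡ 3 [ZMOD 8] ∨ m ≡ 5 [ZMOD 8]) ∧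
        n = 2 ^ 16 * m} ∪
      {n : ℤ | ∃ m : ℤ, m ≡ 7 [ZMOD 8] ∧ n = 2 ^ 16 * m ∧
        ((∃ (t : ℤ) (l : ℕ), l ≡ 1 [MOD 4] ∧ 5 ≤ l ∧
            n = 2 ^ 16 * (8 * t - 1) * (l : ℤ) ^ 2) ∨
          (∃ t k : ℤ, n = 2 ^ 16 * ((8 * t + 3) * (8 * k - 3))))} ∧
    -- the case `ℓ₁ = ℓ₂ = 2`
    (∀ (a : Z2Q8 → ℤ) (m : ℤ), m ≡ 7 [ZMOD 8] → groupDet a = 2 ^ 16 * m →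
      ellQ8 (evalZ2 a 1) = 2 → ellQ8 (evalZ2 a (-1)) = 2 →
      ∃ t k : ℤ, groupDet a = 2 ^ 16 * ((8 * t + 3) * (8 * k - 3))) := by
  have cases := fun a : Z2Q8 → ℤ => families_of_linked (linked_evenPart_oddPart a)
    (groupDet_Z2Q8_eq a)
  refine ⟨?_, ?_, ?_⟩
  · ext n
    constructor
    · rintro ⟨⟨a, rfl⟩, hodd⟩
      rcases cases a with ⟨-, h⟩ | ⟨h, -⟩
      · exact h
      · exact absurd h (Int.not_even_iff_odd.2 hodd)
    · have odd_of : ∀ r : ℤ, r % 2 = 1 → n ≡ r [ZMOD 16] → Odd n := fun r hr hnr => by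
        rw [Int.odd_iff]
        unfold Int.ModEq at hnr
        omega
      rintro (h | h)
      · exact ⟨mem_of_modEq_one h, odd_of 1 rfl h⟩
      · exact ⟨mem_of_isOddProduct h, odd_of 9 rfl h.1⟩
  · ext n
    constructor
    · rintro ⟨⟨a, rfl⟩, heven⟩
      rcases cases a with ⟨h, -⟩ | ⟨-, (h | h | h) | ⟨m, h1, h2, h⟩⟩
      · exact absurd heven (Int.not_even_iff_odd.2 h)
      · exact Or.inl (Or.inl (Or.inl h))
      · exact Or.inl (Or.inl (Or.inr h))
      · exact Or.inl (Or.inr h)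
      · exact Or.inr ⟨m, h1, h2, h.imp And.left id⟩
    · rintro (((⟨m, rfl⟩ | ⟨m, p, -, hp, rfl⟩) | ⟨m, hm, rfl⟩) |
        ⟨m, -, hm, ⟨t, l, h1, h2, rfl⟩ | ⟨t, k, rfl⟩⟩)
      · exact ⟨mem_two_pow_eighteen m, 2 ^ 17 * m, by ring⟩
      · exact ⟨mem_two_pow_seventeen m hp, 2 ^ 16 * (2 * m + 1) * (p : ℤ) ^ 2, by ring⟩
      · refine ⟨?_, 2 ^ 15 * m, by ring⟩
        unfold Int.ModEq at hm
        by_cases h : m % 4 = 1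
        · rw [show m = 4 * (m / 4) + 1 by omega]
          exact mem_of_modEq_one_four _
        -- Only `m ≡ 3 mod 8` remains, `1` and `5` being `1` mod `4`.
        · rw [show m = (8 * (m / 8) + 3) * (4 * 0 + 1) by omega]
          exact mem_mul_three _ _
      · exact ⟨mem_mul_sq t h1 h2, 2 ^ 15 * m, by rw [hm]; ring⟩
      · refine ⟨?_, 2 ^ 15 * m, by rw [hm]; ring⟩
        rw [show 8 * k - 3 = 4 * (2 * k - 1) + 1 by ring]
        exact mem_mul_three _ _
  · intro a m hm hdet h1 h2
    rw [ellQ8_eq] at h1 h2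
    have h1' : sumSq (QuaternionGroup.oddPart (evalZ2 a 1)) = 2 := by exact_mod_cast h1
    have h2' : sumSq (QuaternionGroup.oddPart (evalZ2 a (-1))) = 2 := by exact_mod_cast h2
    unfold Int.ModEq at hm
    rcases cases a with ⟨h, -⟩ | ⟨-, (⟨k, h⟩ | ⟨k, p, -, -, h⟩ | ⟨k, hk, h⟩) | ⟨k, -, -, h⟩⟩
    · rw [hdet, Int.odd_iff] at h
      omega
    · omega
    · have : m = 2 * ((2 * k + 1) * (p : ℤ) ^ 2) := by linarith
      omega
    · unfold Int.ModEq at hk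
      omega
    · rcases h with ⟨-, h⟩ | h
      · exact absurd ⟨h1', h2'⟩ h
      · exact h
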